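/- Let $w>\mu>0$ and, for $L\ge 2$, consider diffusion-limited pair annihilation and deposition on the torus $\mathbb T_L=\mathbb Z/L\mathbb Z$ together with its activity: the continuous-time Markov chain $(\eta(t),A(t))$ on $\{0,1\}^{\mathbb T_L}\times\mathbb N_0$ with generator $$(\tilde{\mathcal H}f)(\eta,A)=\sum_{k=0}^{L-1}\Big[\mu f(\bar\eta^{k,k+1},A)+w(\eta_k+\eta_{k+1})f(\bar\eta^{k,k+1},A+1)-\big(\mu+w(\eta_k+\eta_{k+1})\big)f(\eta,A)\Big],$$ where $\bar\eta^{k,k+1}$ is $\eta$ with the occupation numbers at $k$ and $k+1$ flipped. For every $s<0$ and every initial configuration $\eta$ with an even number of particles, the limit $$K_L(s)=\lim_{t\to\infty}\frac{1}{Lt}\ln \mathbb E_{\eta,0}\big[e^{sA(t)}\big]$$ exists and does not depend on $\eta$. The function $K_L$ is analytic at the critical point $s_c=\ln(1-\mu/w)<0$. Let $\kappa^c_n(L)=K_L^{(n)}(s_c)$ be the critical cumulants and put $\nu=1-\mu/w\in(0,1)$. (a) For every $k\ge1$, $|\kappa^c_{2k}(L)|\to\infty$ and $|\kappa^c_{2k+1}(L)|\to\infty$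 as $L\to\infty$, and both are of the same order in $L$: $\kappa^c_{2k+1}(L)=\Theta(\kappa^c_{2k}(L))$. (b) For every $n\ge3$, $$\lim_{L\to\infty}L^{2-n}\kappa^c_n(L)=\begin{cases}0,& n\text{ odd},\\ 2w\,\kappa^*_n,& n\text{ even},\end{cases}$$ where for $m\ge2$ $$\kappa^*_{2m}=(2m)!\;\frac{(1-2^{1-2m})\,\zeta(2m-1)}{\pi^{2m-1}}\;\frac{\nu^{2m}\binom{1/2}{m}}{(1-\nu^2)^{m-1/2}} .$$ In particular, in the normalization $w=1/2$ the limit for even $n$ is $\kappa^*_n$. -/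

import Mathlib

open Filter Topology Asymptotics
open scoped ENNReal

noncomputable section

namespace DLPAD

/-- Configurations on the discrete torus `ℤ/Lℤ`; `true` means that the site is occupied. -/
abbrev Config (L : ℕ) : Type := ZMod L → Bool

/-- The occupation number `η_k ∈ {0,1}`. -/
def occ {L : ℕ} (η : Config L) (k : ZMod L) : ℝ := if η k then 1 else 0

/-- The configuration with the occupation numbers at the sites `k` and `k+1` flipped. -/
def flip {L : ℕ} (k : ZMod L) (η : Config L) : Config L :=
  fun j => if j = k ∨ j = k + 1 then !(η j) else η j

/-- The total rate `μ + w (η_k + η_{k+1})` of the transition at the bond `(k, k+1)`. -/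
def rate (w μ : ℝ) {L : ℕ} (η : Config L) (k : ZMod L) : ℝ :=
  μ + w * (occ η k + occ η (k + 1))

/-- Number of particles of a configuration. -/
def particleNumber {L : ℕ} (η : Config L) : ℕ := Set.ncard {k | η k = true}

/-- The empty configuration (it lies in the even sector). -/
def emptyConfig (L : ℕ) : Config L := fun _ => false

/-- State space of the joint process (configuration, activity). -/
abbrev JointState (L : ℕ) : Type := Config L × ℕ

/-- Bounded real functions on the joint state space, with the supremum norm. -/
abbrev BddFun (L : ℕ) : Type := lp (fun _ : JointState L => ℝ) ∞

/-- The generator of the joint process acting on functions: at each bond `(k, k+1)` the pair of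
sites is flipped with rate `μ` (activity unchanged) and with rate `w (η_k + η_{k+1})` (activity
increased by one). -/
def jointGenFun (w μ : ℝ) (L : ℕ) (f : JointState L → ℝ) (x : JointState L) : ℝ :=
  ∑ k ∈ Finset.range L,
    (μ * f (flip (k : ZMod L) x.1, x.2)
      + w * (occ x.1 (k : ZMod L) + occ x.1 ((k : ZMod L) + 1))
          * f (flip (k : ZMod L) x.1, x.2 + 1)
      - rate w μ x.1 (k : ZMod L) * f x)

theorem abs_occ_le_one {L : ℕ} (η : Config L) (k : ZMod L) : |occ η k| ≤ 1 := by
  unfold occ; split <;> simp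

theorem abs_jointGenFun_le (w μ : ℝ) (L : ℕ) (f : JointState L → ℝ) (C : ℝ)
    (hf : ∀ x, |f x| ≤ C) (x : JointState L) :
    |jointGenFun w μ L f x| ≤ (L * (2 * |μ| + 4 * |w|)) * C := by
  have hC : 0 ≤ C := (abs_nonneg _).trans (hf x)
  have key : ∀ k ∈ Finset.range L,
      |μ * f (flip (k : ZMod L) x.1, x.2)
      + w * (occ x.1 (k : ZMod L) + occ x.1 ((k : ZMod L) + 1))
          * f (flip (k : ZMod L) x.1, x.2 + 1)
      - rate w μ x.1 (k : ZMod L) * f x| ≤ (2 * |μ| + 4 * |w|) * C := by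
    intro k _
    set o := occ x.1 (k : ZMod L) + occ x.1 ((k : ZMod L) + 1) with ho
    have h2 : |o| ≤ 2 := by
      have h := abs_add_le (occ x.1 (k : ZMod L)) (occ x.1 ((k : ZMod L) + 1))
      have h1 := abs_occ_le_one x.1 (k : ZMod L)
      have h3 := abs_occ_le_one x.1 ((k : ZMod L) + 1)
      linarith
    have hwo : |w * o| ≤ 2 * |w| := by
      rw [abs_mul]; nlinarith [abs_nonneg w]
    have hr : |rate w μ x.1 (k : ZMod L)| ≤ |μ| + 2 * |w| := by
      unfold rate; exact (abs_add_le _ _).trans (by linarith)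
    have e1 : |μ * f (flip (k : ZMod L) x.1, x.2)| ≤ |μ| * C := by
      rw [abs_mul]; gcongr; exact hf _
    have e2 : |w * o * f (flip (k : ZMod L) x.1, x.2 + 1)| ≤ (2 * |w|) * C := by
      rw [abs_mul]; gcongr; exact hf _
    have e3 : |rate w μ x.1 (k : ZMod L) * f x| ≤ (|μ| + 2 * |w|) * C := by
      rw [abs_mul]; gcongr; exact hf _
    refine (abs_sub _ _).trans ?_
    have e4 := abs_add_le (μ * f (flip (k : ZMod L) x.1, x.2))
      (w * o * f (flip (k : ZMod L) x.1, x.2 + 1))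
    linarith
  refine (Finset.abs_sum_le_sum_abs _ _).trans ((Finset.sum_le_sum key).trans (le_of_eq ?_))
  simp; ring

theorem BddFun.abs_apply_le {L : ℕ} (f : BddFun L) (x : JointState L) : |f x| ≤ ‖f‖ :=
  lp.norm_apply_le_norm ENNReal.top_ne_zero f x

theorem memℓp_jointGenFun (w μ : ℝ) (L : ℕ) (f : BddFun L) :
    Memℓp (E := fun _ : JointState L => ℝ) (jointGenFun w μ L f) ∞ := by
  refine memℓp_infty ⟨(L * (2 * |μ| + 4 * |w|)) * ‖f‖, ?_⟩
  rintro _ ⟨x, rfl⟩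
  exact abs_jointGenFun_le w μ L f _ (BddFun.abs_apply_le f) x

/-- The generator of the joint process as a bounded operator on bounded functions. -/
def jointGen (w μ : ℝ) (L : ℕ) : BddFun L →L[ℝ] BddFun L :=
  LinearMap.mkContinuous
    { toFun := fun f => ⟨jointGenFun w μ L f, memℓp_jointGenFun w μ L f⟩
      map_add' := by
        intro f g
        ext x
        simp only [lp.coeFn_add, Pi.add_apply, jointGenFun]
        rw [← Finset.sum_add_distrib]
        exact Finset.sum_congr rfl fun k _ => by ring
      map_smul' := by
        intro c f
        ext x
        simp only [lp.coeFn_smul, Pi.smul_apply, jointGenFun, smul_eq_mul, RingHom.id_apply]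
        rw [Finset.mul_sum]
        exact Finset.sum_congr rfl fun k _ => by ring }
    (L * (2 * |μ| + 4 * |w|))
    (fun f => lp.norm_le_of_forall_le (by positivity)
      (fun x => abs_jointGenFun_le w μ L f _ (BddFun.abs_apply_le f) x))

/-- The Markov semigroup `exp (t 𝓗̃)` of the joint process. -/
def semigroup (w μ : ℝ) (L : ℕ) (t : ℝ) : BddFun L →L[ℝ] BddFun L :=
  NormedSpace.exp (t • jointGen w μ L)

/-- The indicator function of the event that the activity equals `a`. -/
def activityIndicator (L : ℕ) (a : ℕ) : BddFun L :=
  ⟨fun x => if x.2 = a then 1 else 0, memℓp_infty ⟨1, by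
    rintro _ ⟨x, rfl⟩
    dsimp only
    split <;> simp⟩⟩

/-- The probability that the activity at time `t` equals `a` for the process started from
configuration `η` with activity `0`. -/
def activityProb (w μ : ℝ) (L : ℕ) (η : Config L) (t : ℝ) (a : ℕ) : ℝ :=
  (semigroup w μ L t (activityIndicator L a) : JointState L → ℝ) (η, 0)

/-- The moment generating function `𝔼_{η,0}[exp (s A(t))]` of the activity. -/
def momentGen (w μ : ℝ) (L : ℕ) (η : Config L) (s t : ℝ) : ℝ :=
  ∑' a : ℕ, Real.exp (s * a) * activityProb w μ L η t a

/-- The scaled cumulant generating function at time `t`, `(L t)⁻¹ log 𝔼_{η,0}[exp (s A(t))]`. -/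
def scaledCGF (w μ : ℝ) (L : ℕ) (η : Config L) (s t : ℝ) : ℝ :=
  Real.log (momentGen w μ L η s t) / (L * t)

/-- The long-time limit of the scaled cumulant generating function in the even sector. -/
def limitCGF (w μ : ℝ) (L : ℕ) (s : ℝ) : ℝ :=
  limUnder atTop (fun t : ℝ => scaledCGF w μ L (emptyConfig L) s t)

/-- The critical point `s_c = log (1 - μ/w)`. -/
def criticalPoint (w μ : ℝ) : ℝ := Real.log (1 - μ / w)

/-- The `n`-th cumulant at the critical point for system size `L` in the even sector. -/
def criticalCumulant (w μ : ℝ) (n L : ℕ) : ℝ :=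
  iteratedDeriv n (limitCGF w μ L) (criticalPoint w μ)

/-- `α_m = (1 - 2^(1-2m)) ζ(2m-1) / π^(2m-1)`, used for `m ≥ 2` only. -/
def alpha (m : ℕ) : ℝ :=
  (1 - (2 : ℝ) ^ (1 - 2 * (m : ℤ))) / Real.pi ^ (2 * m - 1) * (riemannZeta (2 * m - 1)).re

/-- `β_{2m}(ν) = ν^(2m) binom(1/2, m) / (1 - ν²)^(m - 1/2)`. -/
def betaEven (ν : ℝ) (m : ℕ) : ℝ :=
  ν ^ (2 * m) * Ring.choose (1 / 2 : ℝ) m / (1 - ν ^ 2) ^ ((m : ℝ) - 1 / 2)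

/-- The rescaled cumulant `κ*_{2m} = (2m)! α_m β_{2m}(ν)` of even order `2m`. -/
def kappaStarEven (ν : ℝ) (m : ℕ) : ℝ :=
  (Nat.factorial (2 * m) : ℝ) * alpha m * betaEven ν m

end DLPAD

end

/-! In the even sector the tilted generator is a free-fermion operator. After a Jordan–Wigner
transformation it is quadratic in fermions with antiperiodic boundary conditions, and a pair state,
a product of factors `1 + G C C` applied to the empty configuration, is an eigenvector as soon as
the amplitudes solve a Riccati equation in each momentum mode (`pairCoeff_riccati`,
`tiltedGen_pairState`). Its eigenvalue is `topEigenvalue`, a sum of square roots over the momenta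
`(2j+1)π/L`.

No other part of the spectrum is needed. The eigenvector depends continuously on `z = exp s` in `(0,
1]`, is constant on the even sector at `z = 1`, and by irreducibility cannot reach the boundary of
the positive cone; connectedness makes it strictly positive for all `z`
(`exists_positive_eigenvector`). A positive eigenvector lies between two positive multiples of the
constant function, and the semigroup preserves order, so the moment generating function is squeezed
between multiples of `exp (t * topEigenvalue)` (`tendsto_scaledCGF`). Hence `K_L(s) = topEigenvalue
/ L` for `s < 0`.

The cumulants then come from one local expansion. Put `ν = exp s_c` and `σ = sin (q/2)`. Along `s =
s_c + σ u` the squared energy, divided by `w²`, is `σ²` times a power series in `u` whose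
coefficients are smooth in `σ` up to `σ = 0`. Its square root has the coefficients `gapCoeff`, so
`κ_n = w n! L⁻¹ ∑ σ_j^(1-n) gapCoeff ν n σ_j` (`criticalCumulant_eq`). At `σ = 0` the series is the
root of `4(1-ν²) + ν²u²`, which is even in `u`: even coefficients are nonzero there, odd ones
vanish. An odd order therefore loses one inverse power of `σ`, and `κ_{2k}` and `κ_{2k+1}` are both
comparable to `∑ σ_j^(1-2k) / L`, provided that the `σ`-derivative of the odd coefficient is nonzero
(`deriv_gapCoeff_odd_zero_ne_zero`). The zeta values come from the momenta near both ends of `(0,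
2π)`, where `L σ_j` tends to `(2j+1)π/2` in the order counted from each end. -/

noncomputable section

namespace DLPAD

/-! ### Power series of the rescaled gap -/

/-- The coefficients of the rescaled squared dispersion relation as functions of `σ = sin (q/2)`. -/
def dispersionCoeff (ν : ℝ) : ℕ → ℝ → ℝ
  | 0, σ => 4 * (1 - ν ^ 2 + ν ^ 2 * σ ^ 2)
  | 1, σ => 4 * σ * ν * (1 - 2 * ν * (1 - σ ^ 2))
  | n + 2, σ => σ ^ n * (ν ^ 2 * (2 ^ (n + 2) - 2) * (1 - 2 * σ ^ 2) ^ 2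
      + 4 * σ ^ 2 * ν * (1 - 2 * ν * (1 - σ ^ 2))) / (n + 2).factorial

/-- The coefficients of the square root of the power series with coefficients
`dispersionCoeff ν n σ`. -/
def gapCoeff (ν : ℝ) : ℕ → ℝ → ℝ
  | 0, σ => 2 * Real.sqrt (1 - ν ^ 2 + ν ^ 2 * σ ^ 2)
  | n + 1, σ => (dispersionCoeff ν (n + 1) σ
      - ∑ i : Fin n, gapCoeff ν (i + 1) σ * gapCoeff ν (n - i) σ)
      / (2 * (2 * Real.sqrt (1 - ν ^ 2 + ν ^ 2 * σ ^ 2)))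
  decreasing_by all_goals omega

theorem dispersion_radicand_pos {ν : ℝ} (h0 : 0 < ν) (h1 : ν < 1) (σ : ℝ) :
    0 < 1 - ν ^ 2 + ν ^ 2 * σ ^ 2 := by
  have : ν ^ 2 < 1 := by nlinarith
  have := mul_nonneg (sq_nonneg ν) (sq_nonneg σ)
  linarith

theorem gapCoeff_zero_pos {ν : ℝ} (h0 : 0 < ν) (h1 : ν < 1) (σ : ℝ) : 0 < gapCoeff ν 0 σ := by
  rw [gapCoeff]
  have := Real.sqrt_pos.2 (dispersion_radicand_pos h0 h1 σ)
  positivity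

theorem contDiff_dispersionCoeff (ν : ℝ) (n : ℕ) : ContDiff ℝ 2 (dispersionCoeff ν n) := by
  match n with
  | 0 => unfold dispersionCoeff; fun_prop
  | 1 => unfold dispersionCoeff; fun_prop
  | n + 2 => unfold dispersionCoeff; fun_prop

/-- The recursion only divides by the zeroth coefficient, which stays positive at `σ = 0`. Two
derivatives suffice for a linear Taylor expansion with quadratic remainder. -/
theorem contDiff_gapCoeff {ν : ℝ} (h0 : 0 < ν) (h1 : ν < 1) (n : ℕ) :
    ContDiff ℝ 2 (gapCoeff ν n) := by
  have hs : ContDiff ℝ 2 (fun σ : ℝ => Real.sqrt (1 - ν ^ 2 + ν ^ 2 * σ ^ 2)) :=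
    ContDiff.sqrt (by fun_prop) fun σ => (dispersion_radicand_pos h0 h1 σ).ne'
  induction n using Nat.strong_induction_on with
  | _ n ih =>
    match n with
    | 0 =>
      have : gapCoeff ν 0 = fun σ => 2 * Real.sqrt (1 - ν ^ 2 + ν ^ 2 * σ ^ 2) := by
        funext σ; rw [gapCoeff]
      rw [this]; fun_prop
    | n + 1 =>
      have : gapCoeff ν (n + 1) = fun σ => (dispersionCoeff ν (n + 1) σ
          - ∑ i : Fin n, gapCoeff ν (i + 1) σ * gapCoeff ν (n - i) σ)
            / (2 * (2 * Real.sqrt (1 - ν ^ 2 + ν ^ 2 * σ ^ 2))) := by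
        funext σ; rw [gapCoeff]
      rw [this]
      refine ContDiff.div ?_ (by fun_prop) fun σ => ?_
      · refine (contDiff_dispersionCoeff ν _).sub (ContDiff.sum fun i _ => ?_)
        exact (ih _ (by omega)).mul (ih _ (by omega))
      · have := Real.sqrt_pos.2 (dispersion_radicand_pos h0 h1 σ)
        positivity

theorem sum_antidiagonal_gapCoeff {ν : ℝ} (h0 : 0 < ν) (h1 : ν < 1) (n : ℕ) (σ : ℝ) :
    ∑ p ∈ Finset.HasAntidiagonal.antidiagonal n, gapCoeff ν p.1 σ * gapCoeff ν p.2 σ =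
      dispersionCoeff ν n σ := by
  have hp := dispersion_radicand_pos h0 h1 σ
  match n with
  | 0 =>
    simp only [Finset.Nat.antidiagonal_zero, Finset.sum_singleton, gapCoeff, dispersionCoeff]
    nlinarith [Real.mul_self_sqrt hp.le]
  | n + 1 =>
    have hs := Real.sqrt_pos.2 hp
    rw [Finset.Nat.sum_antidiagonal_eq_sum_range_succ (fun i j => gapCoeff ν i σ * gapCoeff ν j σ),
      Finset.sum_range_succ', Finset.sum_range_succ]
    have e : ∑ i : Fin n, gapCoeff ν (i + 1) σ * gapCoeff ν (n - i) σ =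
        ∑ k ∈ Finset.range n, gapCoeff ν (k + 1) σ * gapCoeff ν (n + 1 - (k + 1)) σ := by
      rw [← Fin.sum_univ_eq_sum_range
        (fun k => gapCoeff ν (k + 1) σ * gapCoeff ν (n + 1 - (k + 1)) σ)]
      simp
    rw [← e, Nat.sub_self, Nat.sub_zero]
    have h : gapCoeff ν (n + 1) σ * (2 * gapCoeff ν 0 σ) = dispersionCoeff ν (n + 1) σ
      - ∑ i : Fin n, gapCoeff ν (i + 1) σ * gapCoeff ν (n - i) σ := by
      rw [gapCoeff, gapCoeff]
      field_simp
    linarith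

/-- The even coefficients of a formal square root of `c₀ + c₂ X²`. -/
theorem coeff_sqrt_quadratic {A : PowerSeries ℝ} {c₀ c₂ : ℝ} (hc : c₀ ≠ 0)
    (hA : A * A = PowerSeries.C c₀ + PowerSeries.C c₂ * PowerSeries.X ^ 2) :
    (∀ m, A.coeff (2 * m) = A.coeff 0 * Ring.choose (1 / 2 : ℝ) m * (c₂ / c₀) ^ m) ∧
    (∀ m, A.coeff (2 * m + 1) = 0) ∧
    A * PowerSeries.derivative ℝ A = PowerSeries.C c₂ * PowerSeries.X := by
  have hA0 : A.coeff 0 * A.coeff 0 = c₀ := by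
    have := congrArg (PowerSeries.coeff 0) hA
    simpa [PowerSeries.coeff_mul] using this
  have ha : A.coeff 0 ≠ 0 := fun h => hc (by rw [← hA0, h, zero_mul])
  have hd : A * PowerSeries.derivative ℝ A = PowerSeries.C c₂ * PowerSeries.X := by
    have h := congrArg (PowerSeries.derivative ℝ) hA
    rw [Derivation.leibniz, map_add, Derivation.leibniz, PowerSeries.derivative_C,
      PowerSeries.derivative_C, PowerSeries.derivative_pow, PowerSeries.derivative_X] at h
    simp only [smul_eq_mul, mul_zero, add_zero, zero_add, mul_one, Nat.cast_ofNat,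
      Nat.add_one_sub_one, pow_one] at h
    have h2 : (2 : PowerSeries ℝ) ≠ 0 := fun h' => by
      have := congrArg PowerSeries.constantCoeff h'
      rw [map_ofNat, map_zero] at this
      norm_num at this
    exact mul_left_cancel₀ h2 (by linear_combination h)
  -- Multiplying `A A' = c₂ X` by `A` makes the equation linear in `A`, which gives a recursion in
  -- steps of two.
  have hlin : (PowerSeries.C c₀ + PowerSeries.C c₂ * PowerSeries.X ^ 2)
      * PowerSeries.derivative ℝ A = PowerSeries.C c₂ * PowerSeries.X * A := by
    rw [← hA]
    linear_combination A * hd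
  have hrec : ∀ n, c₀ * (A.coeff (n + 2) * (n + 2)) = c₂ * (1 - n) * A.coeff n := by
    intro n
    have h := congrArg (PowerSeries.coeff (n + 1)) hlin
    have e : PowerSeries.coeff (n + 1) (PowerSeries.X ^ 2 * PowerSeries.derivative ℝ A) =
        n * A.coeff n := by
      cases n with
      | zero => simp [PowerSeries.coeff_X_pow_mul']
      | succ n => simp [PowerSeries.coeff_X_pow_mul', PowerSeries.coeff_derivative, mul_comm]
    rw [add_mul, mul_assoc, mul_assoc, map_add, PowerSeries.coeff_C_mul, PowerSeries.coeff_C_mul,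
      PowerSeries.coeff_C_mul, e, PowerSeries.coeff_derivative, PowerSeries.coeff_succ_X_mul] at h
    push_cast at h
    linear_combination h
  refine ⟨?_, ?_, hd⟩
  · intro m
    induction m with
    | zero => simp
    | succ m ih =>
      have h := hrec (2 * m)
      have hch : Ring.choose (1 / 2 : ℝ) (m + 1) * (m + 1) =
          Ring.choose (1 / 2 : ℝ) m * (1 / 2 - m) := by
        have := Ring.choose_smul_choose (1 / 2 : ℝ) (Nat.le_succ m)
        simp only [Nat.succ_eq_add_one, Nat.choose_succ_self_right, Nat.add_sub_cancel_left,
          Ring.choose_one_right, nsmul_eq_mul] at this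
        push_cast at this
        linarith
      rw [ih] at h
      push_cast at h
      have hm : (m : ℝ) + 1 ≠ 0 := by positivity
      rw [mul_add, mul_one, pow_succ]
      refine mul_left_cancel₀ (mul_ne_zero hc hm) ?_
      have : c₀ * (c₂ / c₀) = c₂ := by field_simp
      linear_combination h / 2 - A.coeff 0 * (c₂ / c₀) ^ m * c₂ * hch
        - A.coeff 0 * (c₂ / c₀) ^ m * Ring.choose (1 / 2 : ℝ) (m + 1) * (m + 1) * this
  · intro m
    induction m with
    | zero =>
      have h := congrArg (PowerSeries.coeff 1) hA
      rw [PowerSeries.coeff_mul, Finset.Nat.antidiagonal_succ] at h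
      simp [PowerSeries.coeff_X_pow] at h
      simp only [PowerSeries.coeff_zero_eq_constantCoeff] at ha
      exact (mul_eq_zero.1 (by linarith : PowerSeries.constantCoeff A * A.coeff 1 = 0)).resolve_left
        ha
    | succ m ih =>
      have h := hrec (2 * m + 1)
      rw [ih, mul_zero] at h
      have h3 : ((2 * m + 1 : ℕ) : ℝ) + 2 ≠ 0 := by positivity
      exact (mul_eq_zero.1 ((mul_eq_zero.1 h).resolve_left hc)).resolve_right h3
-- At `σ = 0` the explicit factors of `σ` kill the linear term and every term beyond the quadratic
-- one; the remaining series is even.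
theorem gapSeries_mul_self {ν : ℝ} (h0 : 0 < ν) (h1 : ν < 1) :
    PowerSeries.mk (fun n => gapCoeff ν n 0) * PowerSeries.mk (fun n => gapCoeff ν n 0) =
      PowerSeries.C (4 * (1 - ν ^ 2)) + PowerSeries.C (ν ^ 2) * PowerSeries.X ^ 2 := by
  ext n
  rw [PowerSeries.coeff_mul]
  simp only [PowerSeries.coeff_mk]
  rw [sum_antidiagonal_gapCoeff h0 h1, map_add, PowerSeries.coeff_C_mul, PowerSeries.coeff_X_pow,
    PowerSeries.coeff_C]
  match n with
  | 0 => simp [dispersionCoeff]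
  | 1 => simp [dispersionCoeff]
  | 2 => norm_num [dispersionCoeff, Nat.factorial]
  | n + 3 => simp [dispersionCoeff]

theorem gapCoeff_even_zero {ν : ℝ} (h0 : 0 < ν) (h1 : ν < 1) (m : ℕ) :
    gapCoeff ν (2 * m) 0 = 2 * Real.sqrt (1 - ν ^ 2) * Ring.choose (1 / 2 : ℝ) m
      * (ν ^ 2 / (4 * (1 - ν ^ 2))) ^ m := by
  have hc : 4 * (1 - ν ^ 2) ≠ 0 := by nlinarith
  have h := (coeff_sqrt_quadratic hc (gapSeries_mul_self h0 h1)).1 m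
  simp only [PowerSeries.coeff_mk] at h
  rw [h]
  simp [gapCoeff]

theorem gapCoeff_odd_zero {ν : ℝ} (h0 : 0 < ν) (h1 : ν < 1) (m : ℕ) :
    gapCoeff ν (2 * m + 1) 0 = 0 := by
  have hc : 4 * (1 - ν ^ 2) ≠ 0 := by nlinarith
  have h := (coeff_sqrt_quadratic hc (gapSeries_mul_self h0 h1)).2.1 m
  simpa only [PowerSeries.coeff_mk] using h

theorem choose_half_ne_zero (m : ℕ) : Ring.choose (1 / 2 : ℝ) m ≠ 0 := by
  induction m with
  | zero => simp
  | succ m ih =>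
    have h := Ring.choose_smul_choose (1 / 2 : ℝ) (Nat.le_succ m)
    simp only [Nat.succ_eq_add_one, Nat.choose_succ_self_right, Nat.add_sub_cancel_left,
      Ring.choose_one_right, nsmul_eq_mul] at h
    intro h'
    rw [h', mul_zero] at h
    refine (mul_ne_zero ih ?_) h.symm
    intro h2
    have h3 : (1 : ℝ) = ((2 * m : ℕ) : ℝ) := by push_cast; linarith
    have h4 : 1 = 2 * m := by exact_mod_cast h3
    omega

theorem gapCoeff_even_zero_ne_zero {ν : ℝ} (h0 : 0 < ν) (h1 : ν < 1) (m : ℕ) :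
    gapCoeff ν (2 * m) 0 ≠ 0 := by
  have hp : 0 < 1 - ν ^ 2 := by nlinarith
  rw [gapCoeff_even_zero h0 h1]
  have := Real.sqrt_pos.2 hp
  have h2 := choose_half_ne_zero m
  have h3 : 0 < ν ^ 2 / (4 * (1 - ν ^ 2)) := by positivity
  exact mul_ne_zero (mul_ne_zero (by positivity) h2) (by positivity)

theorem hasDerivAt_gapCoeff {ν : ℝ} (h0 : 0 < ν) (h1 : ν < 1) (n : ℕ) (σ : ℝ) :
    HasDerivAt (gapCoeff ν n) (deriv (gapCoeff ν n) σ) σ :=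
  ((contDiff_gapCoeff h0 h1 n).differentiable (by norm_num) σ).hasDerivAt

theorem deriv_dispersionCoeff_zero (ν : ℝ) (n : ℕ) : deriv (dispersionCoeff ν n) 0 =
    (if n = 1 then 4 * ν * (1 - 2 * ν) else 0) + (if n = 3 then ν ^ 2 else 0) := by
  match n with
  | 0 =>
    have := (((hasDerivAt_pow 2 (0 : ℝ)).const_mul (ν ^ 2)).const_add (1 - ν ^ 2)).const_mul 4
    exact this.deriv.trans (by simp)
  | 1 =>
    have := (((hasDerivAt_id (0 : ℝ)).const_mul 4).mul_const ν).mul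
      ((((hasDerivAt_pow 2 (0 : ℝ)).const_sub 1).const_mul (2 * ν)).const_sub 1)
    exact this.deriv.trans (by simp)
  | n + 2 =>
    have hq : HasDerivAt (fun σ : ℝ => ν ^ 2 * (2 ^ (n + 2) - 2) * (1 - 2 * σ ^ 2) ^ 2
      + 4 * σ ^ 2 * ν * (1 - 2 * ν * (1 - σ ^ 2))) 0 0 := by
      have h1 := (((hasDerivAt_pow 2 (0 : ℝ)).const_mul 2).const_sub 1).fun_pow 2
      have h2 := (((hasDerivAt_pow 2 (0 : ℝ)).const_mul 4).mul_const ν).mul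
        ((((hasDerivAt_pow 2 (0 : ℝ)).const_sub 1).const_mul (2 * ν)).const_sub 1)
      have := (h1.const_mul (ν ^ 2 * (2 ^ (n + 2) - 2))).add h2
      exact this.congr_deriv (by simp)
    have h := ((hasDerivAt_pow n (0 : ℝ)).mul hq).div_const ((n + 2).factorial : ℝ)
    refine h.deriv.trans ?_
    match n with
    | 0 => simp
    | 1 => norm_num [Nat.factorial]
    | n + 2 => simp

/-- This is the `σ`-derivative at `0` of the identity gap² = dispersion; by symmetry both halves of
the product rule agree. -/
theorem derivSeries_mul {ν : ℝ} (h0 : 0 < ν) (h1 : ν < 1) :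
    2 * (PowerSeries.mk (fun n => gapCoeff ν n 0)
      * PowerSeries.mk (fun n => deriv (gapCoeff ν n) 0)) =
      PowerSeries.X * (PowerSeries.C (4 * ν * (1 - 2 * ν)) +
        PowerSeries.C (ν ^ 2) * PowerSeries.X ^ 2) := by
  ext n
  have h : HasDerivAt (dispersionCoeff ν n) (∑ p ∈ Finset.HasAntidiagonal.antidiagonal n,
      (deriv (gapCoeff ν p.1) 0 * gapCoeff ν p.2 0 + gapCoeff ν p.1 0 * deriv (gapCoeff ν p.2) 0))
      0 := by
    have e : dispersionCoeff ν n = fun σ => ∑ p ∈ Finset.HasAntidiagonal.antidiagonal n,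
        gapCoeff ν p.1 σ * gapCoeff ν p.2 σ := by
      funext σ; rw [sum_antidiagonal_gapCoeff h0 h1]
    rw [e]
    exact HasDerivAt.fun_sum fun p _ =>
      (hasDerivAt_gapCoeff h0 h1 p.1 0).mul (hasDerivAt_gapCoeff h0 h1 p.2 0)
  have h2 := h.deriv
  rw [Finset.sum_add_distrib] at h2
  have h3 : ∑ p ∈ Finset.HasAntidiagonal.antidiagonal n,
      deriv (gapCoeff ν p.1) 0 * gapCoeff ν p.2 0 = ∑ p ∈ Finset.HasAntidiagonal.antidiagonal n,
      gapCoeff ν p.1 0 * deriv (gapCoeff ν p.2) 0 := by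
    rw [← Finset.Nat.sum_antidiagonal_swap]
    exact Finset.sum_congr rfl fun p _ => mul_comm _ _
  rw [h3, deriv_dispersionCoeff_zero] at h2
  rw [two_mul, map_add, PowerSeries.coeff_mul]
  simp only [PowerSeries.coeff_mk]
  rw [← h2]
  rw [mul_add, map_add, mul_left_comm, ← pow_succ', PowerSeries.coeff_C_mul,
    PowerSeries.coeff_X_pow, mul_comm PowerSeries.X, PowerSeries.coeff_C_mul, PowerSeries.coeff_X]
  simp

/-- With `A` the gap series at `σ = 0` and `B` its `σ`-derivative there, `A A' = ν² X` turns the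
formula for `2 A B` into one for `B` in terms of `A'`, after cancelling `A X`. -/
theorem deriv_gapCoeff_odd_zero {ν : ℝ} (h0 : 0 < ν) (h1 : ν < 1) (k : ℕ) :
    ν ^ 2 * deriv (gapCoeff ν (2 * k + 1)) 0 = ν ^ 2 * k * gapCoeff ν (2 * k) 0
      + 4 * ν * (1 - 2 * ν) * (k + 1) * gapCoeff ν (2 * k + 2) 0 := by
  have hc : 4 * (1 - ν ^ 2) ≠ 0 := by nlinarith
  have hA := gapSeries_mul_self h0 h1
  have hd := (coeff_sqrt_quadratic hc hA).2.2
  have hB := derivSeries_mul h0 h1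
  set A := PowerSeries.mk (fun n => gapCoeff ν n 0) with hAdef
  set B := PowerSeries.mk (fun n => deriv (gapCoeff ν n) 0) with hBdef
  have hne : A ≠ 0 := fun h => (gapCoeff_zero_pos h0 h1 0).ne' (by
    simpa [hAdef] using congrArg (PowerSeries.coeff 0) h)
  have key : 2 * (PowerSeries.C (ν ^ 2) * B) = PowerSeries.derivative ℝ A *
      (PowerSeries.C (4 * ν * (1 - 2 * ν)) + PowerSeries.C (ν ^ 2) * PowerSeries.X ^ 2) := by
    refine mul_left_cancel₀ (mul_ne_zero hne (PowerSeries.X_ne_zero (R := ℝ))) ?_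
    linear_combination PowerSeries.C (ν ^ 2) * PowerSeries.X * hB - (PowerSeries.X *
      (PowerSeries.C (4 * ν * (1 - 2 * ν)) + PowerSeries.C (ν ^ 2) * PowerSeries.X ^ 2)) * hd
  have h := congrArg (PowerSeries.coeff (2 * k + 1)) key
  have e : PowerSeries.coeff (2 * k + 1) (PowerSeries.derivative ℝ A * PowerSeries.X ^ 2) =
      2 * k * gapCoeff ν (2 * k) 0 := by
    cases k with
    | zero => simp [PowerSeries.coeff_mul_X_pow']
    | succ k =>
      rw [PowerSeries.coeff_mul_X_pow', if_pos (by omega), PowerSeries.coeff_derivative, hAdef,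
        PowerSeries.coeff_mk, show 2 * (k + 1) + 1 - 2 + 1 = 2 * (k + 1) by omega,
        show 2 * (k + 1) + 1 - 2 = 2 * k + 1 by omega]
      push_cast; ring
  rw [two_mul (_ * B), map_add, PowerSeries.coeff_C_mul, mul_add, map_add,
    mul_comm _ (PowerSeries.C _),
    mul_left_comm, PowerSeries.coeff_C_mul, PowerSeries.coeff_C_mul, e,
    PowerSeries.coeff_derivative, hBdef, hAdef, PowerSeries.coeff_mk, PowerSeries.coeff_mk] at h
  push_cast at h
  linear_combination h / 2

theorem deriv_gapCoeff_odd_zero_ne_zero {ν : ℝ} (h0 : 0 < ν) (h1 : ν < 1) {k : ℕ} (hk : 1 ≤ k) :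
    deriv (gapCoeff ν (2 * k + 1)) 0 ≠ 0 := by
  have hp : 0 < 1 - ν ^ 2 := by nlinarith
  have h := deriv_gapCoeff_odd_zero h0 h1 k
  have hne := gapCoeff_even_zero_ne_zero h0 h1 k
  have hrec : (1 - ν ^ 2) * (4 * (k + 1)) * gapCoeff ν (2 * k + 2) 0 =
      ν ^ 2 * (1 / 2 - k) * gapCoeff ν (2 * k) 0 := by
    have hch := Ring.choose_smul_choose (1 / 2 : ℝ) (Nat.le_succ k)
    simp only [Nat.succ_eq_add_one, Nat.choose_succ_self_right, Nat.add_sub_cancel_left,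
      Ring.choose_one_right, nsmul_eq_mul] at hch
    push_cast at hch
    rw [show 2 * k + 2 = 2 * (k + 1) by ring, gapCoeff_even_zero h0 h1, gapCoeff_even_zero h0 h1,
      pow_succ (ν ^ 2 / (4 * (1 - ν ^ 2)))]
    have : (1 - ν ^ 2) * 4 * (ν ^ 2 / (4 * (1 - ν ^ 2))) = ν ^ 2 := by field_simp
    linear_combination 2 * Real.sqrt (1 - ν ^ 2) * (ν ^ 2 / (4 * (1 - ν ^ 2))) ^ k * (ν ^ 2) * hch
      + 2 * Real.sqrt (1 - ν ^ 2) * (ν ^ 2 / (4 * (1 - ν ^ 2))) ^ k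
        * ((k + 1) * Ring.choose (1 / 2 : ℝ) (k + 1)) * this
  intro h'
  rw [h', mul_zero] at h
  have hk' : (1 : ℝ) ≤ k := by exact_mod_cast hk
  have h2 : ν ^ 2 * (gapCoeff ν (2 * k) 0 * ((1 - ν ^ 2) * k + ν * (1 - 2 * ν) * (1 / 2 - k))) =
      0 := by
    linear_combination -(1 - ν ^ 2) * h - ν * (1 - 2 * ν) * hrec
  -- The value is `1 - ν/2` at `k = 1` and grows by `1 - ν + ν²` with each step in `k`. At `k = 0`
  -- it would vanish for `ν = 1/2`.
  have h3 : 0 < (1 - ν ^ 2) * k + ν * (1 - 2 * ν) * (1 / 2 - k) := by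
    nlinarith [mul_pos h0 (sub_pos.2 h1), mul_nonneg (sub_nonneg.2 hk') (sub_nonneg.2 h1.le),
      mul_nonneg (sub_nonneg.2 hk') h0.le,
      mul_nonneg (mul_nonneg (sub_nonneg.2 hk') h0.le) (sub_nonneg.2 h1.le)]
  exact (mul_ne_zero (by positivity) (mul_ne_zero hne h3.ne')) h2

/-! ### Sums of inverse powers of `sin (q/2)` -/

/-- `sin (q / 2)` for the antiperiodic momentum `q = (2 j + 1) π / L`. -/
def sinHalf (L j : ℕ) : ℝ := Real.sin ((2 * j + 1) * Real.pi / (2 * L))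

/-- The normalized sum of the `p`-th inverse powers of `sin (q / 2)` over all momenta. -/
def invSinSum (p L : ℕ) : ℝ := (∑ j ∈ Finset.range L, (sinHalf L j)⁻¹ ^ p) / L

theorem sinHalf_pos {L j : ℕ} (h : j < L) : 0 < sinHalf L j := by
  have hL : (0 : ℝ) < L := by exact_mod_cast (by omega : 0 < L)
  have hj : (j : ℝ) + 1 ≤ L := by exact_mod_cast h
  refine Real.sin_pos_of_pos_of_lt_pi (by positivity) ?_
  rw [div_lt_iff₀ (by positivity)]
  nlinarith [Real.pi_pos]

theorem sinHalf_le_one (L j : ℕ) : sinHalf L j ≤ 1 := Real.sin_le_one _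

theorem one_le_inv_sinHalf {L j : ℕ} (h : j < L) : 1 ≤ (sinHalf L j)⁻¹ :=
  (one_le_inv₀ (sinHalf_pos h)).2 (sinHalf_le_one L j)

theorem invSinSum_mono {p q : ℕ} (h : p ≤ q) (L : ℕ) : invSinSum p L ≤ invSinSum q L := by
  unfold invSinSum
  gcongr with j hj
  exact one_le_inv_sinHalf (Finset.mem_range.1 hj)

/-- Follows from `sin x ≤ x`. The harmonic lower bound gives divergence already for `p = 1`, the
logarithmic case governing orders 2 and 3. -/
theorem sum_inv_odd_le_invSinSum {p : ℕ} (hp : 1 ≤ p) {L : ℕ} (hL : 0 < L) :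
    2 / Real.pi * ∑ j ∈ Finset.range L, 1 / (2 * (j : ℝ) + 1) ≤ invSinSum p L := by
  refine le_trans ?_ (invSinSum_mono hp L)
  have hL' : (0 : ℝ) < L := by exact_mod_cast hL
  rw [invSinSum, le_div_iff₀ hL', Finset.mul_sum, Finset.sum_mul]
  refine Finset.sum_le_sum fun j hj => ?_
  have hpos := sinHalf_pos (Finset.mem_range.1 hj)
  have hle : sinHalf L j ≤ (2 * j + 1) * Real.pi / (2 * L) := Real.sin_le (by positivity)
  have h2 := inv_anti₀ hpos hle
  rw [pow_one]
  refine le_trans (le_of_eq ?_) h2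
  have := Real.pi_pos
  field_simp

theorem tendsto_invSinSum_atTop {p : ℕ} (hp : 1 ≤ p) : Tendsto (invSinSum p) atTop atTop := by
  have h1 : Tendsto (fun n : ℕ => ∑ j ∈ Finset.range n, 1 / (2 * (j : ℝ) + 1)) atTop atTop := by
    refine tendsto_atTop_mono (f := fun n : ℕ => 1 / 2 * ∑ j ∈ Finset.range n, 1 / ((j : ℝ) + 1))
      (fun n => ?_) ?_
    · rw [Finset.mul_sum]
      refine Finset.sum_le_sum fun j _ => ?_
      rw [div_mul_div_comm, one_mul]
      exact one_div_le_one_div_of_le (by positivity) (by linarith)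
    · exact Real.tendsto_sum_range_one_div_nat_succ_atTop.const_mul_atTop (by norm_num)
  have h2 := h1.const_mul_atTop (by positivity : 0 < 2 / Real.pi)
  refine tendsto_atTop_mono' _ ?_ h2
  filter_upwards [eventually_gt_atTop 0] with L hL
  exact sum_inv_odd_le_invSinSum hp hL

/-- Split at `σ = ε`: below it one more inverse power gains a factor `ε`, above it the summand is
bounded. -/
theorem invSinSum_le_add (p : ℕ) {ε : ℝ} (hε : 0 < ε) (L : ℕ) :
    invSinSum p L ≤ ε * invSinSum (p + 1) L + ε⁻¹ ^ p := by
  rcases Nat.eq_zero_or_pos L with rfl | hL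
  · simp [invSinSum]; positivity
  have hL' : (0 : ℝ) < L := by exact_mod_cast hL
  have h : ∑ j ∈ Finset.range L, (sinHalf L j)⁻¹ ^ p ≤
      ∑ j ∈ Finset.range L, (ε * (sinHalf L j)⁻¹ ^ (p + 1) + ε⁻¹ ^ p) := by
    refine Finset.sum_le_sum fun j hj => ?_
    have hpos := sinHalf_pos (Finset.mem_range.1 hj)
    rcases le_total (sinHalf L j) ε with h | h
    · have : 1 ≤ ε * (sinHalf L j)⁻¹ := by
        rw [← div_eq_mul_inv, le_div_iff₀ hpos]; linarith
      have h2 : 0 ≤ (sinHalf L j)⁻¹ ^ p := by positivity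
      have h3 : 0 ≤ ε⁻¹ ^ p := by positivity
      rw [pow_succ]
      nlinarith
    · have h2 : (sinHalf L j)⁻¹ ^ p ≤ ε⁻¹ ^ p := by
        gcongr
      have h3 : 0 ≤ ε * (sinHalf L j)⁻¹ ^ (p + 1) := by positivity
      linarith
  rw [Finset.sum_add_distrib, ← Finset.mul_sum, Finset.sum_const, Finset.card_range,
    nsmul_eq_mul] at h
  unfold invSinSum
  rw [div_le_iff₀ hL', add_mul, mul_assoc, div_mul_cancel₀ _ hL'.ne']
  linarith

theorem tendsto_invSinSum_ratio (p : ℕ) :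
    Tendsto (fun L => invSinSum p L / invSinSum (p + 1) L) atTop (𝓝 0) := by
  have hT := tendsto_invSinSum_atTop (Nat.le_add_left 1 p)
  rw [Metric.tendsto_atTop']
  intro δ hδ
  have hε : 0 < δ / 2 := by positivity
  obtain ⟨N, hN⟩ := eventually_atTop.1 (hT.eventually_gt_atTop ((δ / 2)⁻¹ ^ p / (δ / 2)))
  refine ⟨N, fun L hL => ?_⟩
  have h1 := hN L hL.le
  have h0 : 0 < invSinSum (p + 1) L := lt_of_le_of_lt (by positivity) h1
  have h2 := invSinSum_le_add p hε L
  rw [div_lt_iff₀ hε] at h1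
  have h3 : 0 ≤ invSinSum p L := by
    unfold invSinSum
    refine div_nonneg (Finset.sum_nonneg fun j hj => ?_) (by positivity)
    have := sinHalf_pos (Finset.mem_range.1 hj)
    positivity
  rw [Real.dist_eq, sub_zero, abs_of_nonneg (by positivity), div_lt_iff₀ h0]
  linarith

/-- Small `σ` dominates the sum, so the weight may be frozen at its value at `0`; the error has one
inverse power less and is negligible by `tendsto_invSinSum_ratio`. -/
theorem tendsto_weighted_ratio {p : ℕ} {h : ℝ → ℝ} {c M : ℝ}
    (hh : ∀ σ ∈ Set.Ioc (0 : ℝ) 1, |h σ - c| ≤ M * σ) :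
    Tendsto (fun L => ((∑ j ∈ Finset.range L, (sinHalf L j)⁻¹ ^ (p + 1) * h (sinHalf L j)) / L)
      / invSinSum (p + 1) L) atTop (𝓝 c) := by
  have hT := tendsto_invSinSum_atTop (Nat.le_add_left 1 p)
  rw [tendsto_iff_norm_sub_tendsto_zero]
  have h0 : Tendsto (fun L => M * (invSinSum p L / invSinSum (p + 1) L)) atTop (𝓝 0) := by
    simpa using (tendsto_invSinSum_ratio p).const_mul M
  refine squeeze_zero' (Eventually.of_forall fun _ => norm_nonneg _) ?_ h0
  filter_upwards [hT.eventually_gt_atTop 0, eventually_gt_atTop 0] with L hpos hL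
  have hL' : (0 : ℝ) < L := by exact_mod_cast hL
  have e : (∑ j ∈ Finset.range L, (sinHalf L j)⁻¹ ^ (p + 1) * h (sinHalf L j)) / L
      / invSinSum (p + 1) L - c = (∑ j ∈ Finset.range L, (sinHalf L j)⁻¹ ^ (p + 1)
        * (h (sinHalf L j) - c)) / L / invSinSum (p + 1) L := by
    rw [div_sub' hpos.ne', div_left_inj' hpos.ne', invSinSum]
    simp only [mul_sub, Finset.sum_sub_distrib, ← Finset.sum_mul]
    ring
  rw [e, Real.norm_eq_abs, abs_div, abs_of_pos hpos, abs_div, abs_of_pos hL', ← mul_div_assoc]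
  gcongr
  rw [invSinSum, mul_div_assoc', Finset.mul_sum]
  gcongr
  refine (Finset.abs_sum_le_sum_abs _ _).trans (Finset.sum_le_sum fun j hj => ?_)
  have hs := sinHalf_pos (Finset.mem_range.1 hj)
  rw [abs_mul, abs_of_pos (by positivity)]
  calc _ ≤ (sinHalf L j)⁻¹ ^ (p + 1) * (M * sinHalf L j) := by
        gcongr; exact hh _ ⟨hs, sinHalf_le_one _ _⟩
    _ = _ := by rw [pow_succ]; field_simp

theorem sinHalf_reflect {L j : ℕ} (h : j < L) : sinHalf L (L - 1 - j) = sinHalf L j := by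
  have hL : (0 : ℝ) < L := by exact_mod_cast (by omega : 0 < L)
  unfold sinHalf
  rw [← Real.sin_pi_sub]
  congr 1
  rw [Nat.cast_sub (by omega), Nat.cast_sub (by omega)]
  field_simp
  push_cast
  ring

/-- The reflection `q ↦ 2π - q` preserves `σ`. The two halves have equal limits, which is the source
of the factor `2` in the final constant. -/
theorem sum_sinHalf_fold (f : ℝ → ℝ) (L : ℕ) : ∑ j ∈ Finset.range L, f (sinHalf L j) =
    ∑ j ∈ Finset.range ((L + 1) / 2), f (sinHalf L j)
      + ∑ j ∈ Finset.range (L / 2), f (sinHalf L j) := by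
  have h : L = (L + 1) / 2 + L / 2 := by omega
  conv_lhs => rw [h, Finset.sum_range_add, ← h]
  congr 1
  rw [← Finset.sum_range_reflect]
  refine Finset.sum_congr rfl fun j hj => ?_
  have hj := Finset.mem_range.1 hj
  rw [← sinHalf_reflect (by omega : j < L)]
  congr 2
  omega

/-- Dominated convergence for series. The bound on `N` keeps the angles in `[0, π/2]`, where
Jordan's inequality applies. -/
theorem tendsto_sum_inv_sinHalf {p : ℕ} (hp : 2 ≤ p) {N : ℕ → ℕ} (hN : ∀ L, N L ≤ (L + 1) / 2)
    (hN' : Tendsto N atTop atTop) :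
    Tendsto (fun L : ℕ => ∑ j ∈ Finset.range (N L), (L * sinHalf L j)⁻¹ ^ p) atTop
      (𝓝 (∑' j : ℕ, (2 / ((2 * j + 1) * Real.pi)) ^ p)) := by
  have hsum : Summable fun j : ℕ => (1 / ((j : ℝ) + 1)) ^ p := by
    have := (summable_nat_add_iff 1).2 (Real.summable_one_div_nat_pow.2 (by omega : 1 < p))
    simpa [div_pow] using this
  have key := tendsto_tsum_of_dominated_convergence (𝓕 := atTop)
    (f := fun (L : ℕ) (j : ℕ) => if j < N L then (L * sinHalf L j)⁻¹ ^ p else 0)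
    (g := fun j : ℕ => (2 / ((2 * j + 1) * Real.pi)) ^ p) hsum ?_ ?_
  · refine key.congr fun L => ?_
    rw [tsum_eq_sum (s := Finset.range (N L))]
    · exact Finset.sum_congr rfl fun j hj => if_pos (Finset.mem_range.1 hj)
    · intro j hj; exact if_neg (by simpa using hj)
  · intro j
    have h1 : Tendsto (fun L : ℕ => ((L : ℝ) * sinHalf L j)) atTop
        (𝓝 ((2 * j + 1) * Real.pi / 2)) := by
      have hd : Tendsto (fun x : ℝ => Real.sin x / x) (𝓝[≠] 0) (𝓝 1) := by
        have := (Real.hasDerivAt_sin 0).tendsto_slope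
        simpa [slope_fun_def, div_eq_inv_mul] using this
      have hx : Tendsto (fun L : ℕ => (2 * j + 1) * Real.pi / (2 * (L : ℝ))) atTop (𝓝[≠] 0) := by
        rw [tendsto_nhdsWithin_iff]
        constructor
        · have := (tendsto_const_div_atTop_nhds_zero_nat ((2 * j + 1) * Real.pi / 2))
          refine this.congr fun L => ?_
          rw [div_div]
        · filter_upwards [eventually_gt_atTop 0] with L hL
          have hL' : (0 : ℝ) < L := by exact_mod_cast hL
          have : 0 < (2 * j + 1) * Real.pi / (2 * (L : ℝ)) := by positivity
          exact this.ne'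
      have h2 := (hd.comp hx).mul_const ((2 * j + 1) * Real.pi / 2)
      rw [one_mul] at h2
      refine h2.congr' ?_
      filter_upwards [eventually_gt_atTop 0] with L hL
      have hL' : (0 : ℝ) < L := by exact_mod_cast hL
      simp only [Function.comp_apply, sinHalf]
      have := Real.pi_pos
      field_simp
    have h3 := (h1.inv₀ (by positivity)).pow p
    rw [inv_div] at h3
    refine h3.congr' ?_
    filter_upwards [hN'.eventually_gt_atTop j] with L hL
    rw [if_pos hL]
  · refine Eventually.of_forall fun L j => ?_
    split_ifs with h
    · have hj : 2 * j + 1 ≤ L := by have := hN L; omega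
      have hL' : (0 : ℝ) < L := by exact_mod_cast (by omega : 0 < L)
      have hs := sinHalf_pos (by omega : j < L)
      have hjr : 2 * (j : ℝ) + 1 ≤ L := by exact_mod_cast hj
      rw [Real.norm_of_nonneg (by positivity), one_div]
      gcongr
      -- Jordan's inequality gives `L σ ≥ 2j + 1 ≥ j + 1`, a bound independent of `L`.
      have h1 := Real.mul_le_sin (x := (2 * j + 1) * Real.pi / (2 * L)) (by positivity) (by
        rw [div_le_div_iff₀ (by positivity) (by positivity)]
        nlinarith [Real.pi_pos])
      have h2 : 2 / Real.pi * ((2 * j + 1) * Real.pi / (2 * L)) = (2 * j + 1) / L := by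
        have := Real.pi_pos
        field_simp
      rw [h2, div_le_iff₀ hL'] at h1
      unfold sinHalf
      have : (0 : ℝ) ≤ j := by positivity
      linarith
    · simp; positivity

theorem tendsto_invSinSum_scaled {p : ℕ} (hp : 1 ≤ p) :
    Tendsto (fun L : ℕ => invSinSum (p + 1) L / (L : ℝ) ^ p) atTop
      (𝓝 (2 * ∑' j : ℕ, (2 / ((2 * j + 1) * Real.pi)) ^ (p + 1))) := by
  have h1 := tendsto_sum_inv_sinHalf (p := p + 1) (by omega) (N := fun L => (L + 1) / 2)
    (fun L => le_rfl) (tendsto_atTop_atTop.2 fun b => ⟨2 * b, fun a ha => by omega⟩)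
  have h2 := tendsto_sum_inv_sinHalf (p := p + 1) (by omega) (N := fun L => L / 2)
    (fun L => by omega) (tendsto_atTop_atTop.2 fun b => ⟨2 * b, fun a ha => by omega⟩)
  have h3 := h1.add h2
  rw [← two_mul] at h3
  refine h3.congr fun L => ?_
  rw [invSinSum, ← sum_sinHalf_fold (fun x => (L * x)⁻¹ ^ (p + 1)), div_div, ← pow_succ',
    Finset.sum_div]
  refine Finset.sum_congr rfl fun j _ => ?_
  rw [mul_inv, mul_pow, inv_pow, mul_comm]
  rfl

theorem tendsto_invSinSum_div_pow {p : ℕ} (hp : 1 ≤ p) :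
    Tendsto (fun L : ℕ => invSinSum p L / (L : ℝ) ^ p) atTop (𝓝 0) := by
  have h := (tendsto_invSinSum_ratio p).mul (tendsto_invSinSum_scaled hp)
  rw [zero_mul] at h
  refine h.congr' ?_
  filter_upwards [(tendsto_invSinSum_atTop (Nat.le_add_left 1 p)).eventually_gt_atTop 0] with L hL
  field_simp

theorem riemannZeta_natCast_re {p : ℕ} (hp : 2 ≤ p) :
    (riemannZeta p).re = ∑' n : ℕ, 1 / (n : ℝ) ^ p := by
  rw [zeta_nat_eq_tsum_of_gt_one hp]
  have h : ∀ n : ℕ, (1 / (n : ℂ) ^ p) = ((1 / (n : ℝ) ^ p : ℝ) : ℂ) := fun n => by simp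
  rw [tsum_congr h, ← Complex.ofReal_tsum, Complex.ofReal_re]

theorem tsum_one_div_odd_pow {p : ℕ} (hp : 2 ≤ p) :
    ∑' k : ℕ, 1 / ((2 * k + 1 : ℕ) : ℝ) ^ p =
      (1 - (1 / 2) ^ p) * ∑' n : ℕ, 1 / (n : ℝ) ^ p := by
  have hs : Summable fun n : ℕ => 1 / (n : ℝ) ^ p := Real.summable_one_div_nat_pow.2 hp
  have he : Summable fun k : ℕ => 1 / ((2 * k : ℕ) : ℝ) ^ p :=
    hs.comp_injective (i := fun k : ℕ => 2 * k) (fun a b h => by simpa using h)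
  have ho : Summable fun k : ℕ => 1 / ((2 * k + 1 : ℕ) : ℝ) ^ p :=
    hs.comp_injective (i := fun k : ℕ => 2 * k + 1) (fun a b h => by simpa using h)
  have hsplit := tsum_even_add_odd (f := fun n : ℕ => 1 / (n : ℝ) ^ p) he ho
  have heven : ∑' k : ℕ, 1 / ((2 * k : ℕ) : ℝ) ^ p = (1 / 2) ^ p * ∑' n : ℕ, 1 / (n : ℝ) ^ p := by
    rw [← tsum_mul_left]
    refine tsum_congr fun k => ?_
    rw [Nat.cast_mul, mul_pow, one_div_pow, one_div_mul_one_div, Nat.cast_ofNat]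
  linarith

theorem tsum_inv_odd_pow {p : ℕ} (hp : 2 ≤ p) :
    ∑' j : ℕ, (2 / ((2 * (j : ℝ) + 1) * Real.pi)) ^ p =
      (2 / Real.pi) ^ p * ((1 - (1 / 2) ^ p) * (riemannZeta p).re) := by
  rw [riemannZeta_natCast_re hp, ← tsum_one_div_odd_pow hp, ← tsum_mul_left]
  refine tsum_congr fun j => ?_
  have h := Real.pi_pos
  have : 2 / ((2 * (j : ℝ) + 1) * Real.pi) = 2 / Real.pi * (1 / ((2 * j + 1 : ℕ) : ℝ)) := by
    push_cast
    field_simp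
  rw [this, mul_pow, one_div_pow]

/-! ### Taylor bounds and the energies near the critical point -/

theorem exists_bound_sub_zero {h : ℝ → ℝ} (hh : ContDiff ℝ 2 h) :
    ∃ M, ∀ σ ∈ Set.Icc (0 : ℝ) 1, |h σ - h 0| ≤ M * σ := by
  obtain ⟨C, hC⟩ := exists_taylor_mean_remainder_bound (f := h) (n := 0) zero_le_one
    ((hh.of_le (by norm_num)).contDiffOn)
  exact ⟨C, fun σ hσ => by simpa using hC σ hσ⟩

theorem exists_bound_sub_linear {h : ℝ → ℝ} (hh : ContDiff ℝ 2 h) :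
    ∃ M, ∀ σ ∈ Set.Icc (0 : ℝ) 1, |h σ - h 0 - deriv h 0 * σ| ≤ M * σ ^ 2 := by
  obtain ⟨C, hC⟩ := exists_taylor_mean_remainder_bound (f := h) (n := 1) zero_le_one
    ((hh.of_le (by norm_num)).contDiffOn)
  refine ⟨C, fun σ hσ => ?_⟩
  have := hC σ hσ
  rw [taylorWithinEval_succ, iteratedDerivWithin_one,
    ((hh.differentiable (by norm_num)) 0).derivWithin
      (uniqueDiffOn_Icc_zero_one 0 (by simp))] at this
  simp only [taylor_within_zero_eval, sub_zero, Real.norm_eq_abs] at this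
  convert this using 2
  simp
  ring

/-- The squared single-particle energy at momentum `q` and fugacity `z = exp s`. -/
def dispersion (w μ z q : ℝ) : ℝ :=
  ((μ + w * z) * Real.cos q - w) ^ 2 + μ * (μ + 2 * w * z) * Real.sin q ^ 2

/-- The antiperiodic momenta `(2 j + 1) π / L`. -/
def momentum (L j : ℕ) : ℝ := (2 * j + 1) * Real.pi / L

/-- The largest eigenvalue of the tilted generator in the even sector. -/
def topEigenvalue (w μ : ℝ) (L : ℕ) (z : ℝ) : ℝ :=
  -(μ + w) * L + ∑ j ∈ Finset.range L, Real.sqrt (dispersion w μ z (momentum L j))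

/-- The squared dispersion relation divided by `w ^ 2`, in terms of `σ = sin (q / 2)`. -/
def radicand (ν σ z : ℝ) : ℝ :=
  (z - ν) ^ 2 * (1 - 2 * σ ^ 2) ^ 2 + 4 * σ ^ 2 * (z - ν) * (1 - 2 * ν * (1 - σ ^ 2))
    + 4 * σ ^ 2 * (1 - ν ^ 2 + ν ^ 2 * σ ^ 2)

theorem dispersion_eq {w μ : ℝ} (hw : w ≠ 0) (z : ℝ) (L j : ℕ) :
    dispersion w μ z (momentum L j) = w ^ 2 * radicand (1 - μ / w) (sinHalf L j) z := by
  have hq : momentum L j = 2 * ((2 * j + 1) * Real.pi / (2 * L)) := by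
    unfold momentum; rw [mul_div_assoc', mul_div_mul_left _ _ two_ne_zero]
  have hc : Real.cos (momentum L j) = 1 - 2 * sinHalf L j ^ 2 := by
    rw [hq, Real.cos_two_mul, Real.cos_sq', sinHalf]; ring
  rw [dispersion, Real.sin_sq, hc, radicand]
  field_simp
  ring

/-- The normalized single-particle energy as a function of `s`. -/
def energy (ν σ s : ℝ) : ℝ := Real.sqrt (radicand ν σ (Real.exp s))

theorem radicand_self (ν σ : ℝ) : radicand ν σ ν = 4 * σ ^ 2 * (1 - ν ^ 2 + ν ^ 2 * σ ^ 2) := by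
  unfold radicand; ring

theorem radicand_self_pos {ν σ : ℝ} (h0 : 0 < ν) (h1 : ν < 1) (hσ : 0 < σ) :
    0 < radicand ν σ ν := by
  rw [radicand_self]
  have := dispersion_radicand_pos h0 h1 σ
  positivity

theorem contDiffAt_energy {ν σ : ℝ} (h0 : 0 < ν) (h1 : ν < 1) (hσ : 0 < σ)
    (n : WithTop ℕ∞) : ContDiffAt ℝ n (energy ν σ) (Real.log ν) := by
  unfold energy
  refine ContDiffAt.sqrt ?_ ?_
  · unfold radicand
    have : ContDiffAt ℝ n Real.exp (Real.log ν) := Real.contDiff_exp.contDiffAt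
    fun_prop
  · rw [Real.exp_log h0]
    exact (radicand_self_pos h0 h1 hσ).ne'

theorem iteratedDeriv_radicand (ν σ : ℝ) (n : ℕ) :
    iteratedDeriv (n + 1) (fun s => radicand ν σ (Real.exp s)) = fun s =>
      (1 - 2 * σ ^ 2) ^ 2 * (2 ^ (n + 1) * Real.exp s ^ 2) +
      (4 * σ ^ 2 * (1 - 2 * ν * (1 - σ ^ 2)) - 2 * ν * (1 - 2 * σ ^ 2) ^ 2) * Real.exp s := by
  induction n with
  | zero =>
    rw [zero_add, iteratedDeriv_one]
    funext s
    have h := Real.hasDerivAt_exp s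
    have h2 := (((h.sub_const ν).fun_pow 2).mul_const ((1 - 2 * σ ^ 2) ^ 2)).add
      (((h.sub_const ν).const_mul (4 * σ ^ 2)).mul_const (1 - 2 * ν * (1 - σ ^ 2)))
    have h3 := h2.add_const (4 * σ ^ 2 * (1 - ν ^ 2 + ν ^ 2 * σ ^ 2))
    refine h3.deriv.trans ?_
    simp only [Nat.cast_ofNat]
    ring
  | succ n ih =>
    rw [iteratedDeriv_succ, ih]
    funext s
    have h := Real.hasDerivAt_exp s
    have h2 := (((h.fun_pow 2).const_mul (2 ^ (n + 1))).const_mul ((1 - 2 * σ ^ 2) ^ 2)).add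
      (h.const_mul (4 * σ ^ 2 * (1 - 2 * ν * (1 - σ ^ 2)) - 2 * ν * (1 - 2 * σ ^ 2) ^ 2))
    refine h2.deriv.trans ?_
    simp only [Nat.cast_ofNat]
    ring

/-- The substitution `s = s_c + σ u` at the level of Taylor coefficients; it identifies
`dispersionCoeff`. -/
theorem iteratedDeriv_radicand_critical {ν : ℝ} (h0 : 0 < ν) (σ : ℝ) (n : ℕ) :
    σ ^ n * (iteratedDeriv n (fun s => radicand ν σ (Real.exp s)) (Real.log ν) / n.factorial) =
      σ ^ 2 * dispersionCoeff ν n σ := by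
  match n with
  | 0 =>
    rw [iteratedDeriv_zero, Real.exp_log h0, radicand_self]
    simp [dispersionCoeff]; ring
  | 1 =>
    rw [iteratedDeriv_radicand]
    beta_reduce
    rw [Real.exp_log h0]
    simp [dispersionCoeff]; ring
  | n + 2 =>
    rw [iteratedDeriv_radicand]
    beta_reduce
    rw [Real.exp_log h0]
    simp only [dispersionCoeff]
    ring

/-- Both sides are coefficients of square roots of the same power series. Such roots agree up to
sign in a domain, and positive constant terms fix the sign. -/
theorem iteratedDeriv_energy {ν σ : ℝ} (h0 : 0 < ν) (h1 : ν < 1) (hσ : 0 < σ) (n : ℕ) :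
    σ ^ n * (iteratedDeriv n (energy ν σ) (Real.log ν) / n.factorial) = σ * gapCoeff ν n σ := by
  set P : PowerSeries ℝ := PowerSeries.mk fun n =>
    σ ^ n * (iteratedDeriv n (energy ν σ) (Real.log ν) / n.factorial) with hP
  set Q : PowerSeries ℝ := PowerSeries.mk fun n => σ * gapCoeff ν n σ with hQ
  suffices h : P = Q by
    have := congrArg (PowerSeries.coeff n) h
    simpa [hP, hQ] using this
  have hE : 0 < energy ν σ (Real.log ν) := by
    unfold energy; rw [Real.exp_log h0]; exact Real.sqrt_pos.2 (radicand_self_pos h0 h1 hσ)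
  have hPP : P * P = Q * Q := by
    ext n
    rw [PowerSeries.coeff_mul, PowerSeries.coeff_mul]
    simp only [hP, hQ, PowerSeries.coeff_mk]
    have e1 : ∑ p ∈ Finset.HasAntidiagonal.antidiagonal n, σ * gapCoeff ν p.1 σ *
        (σ * gapCoeff ν p.2 σ) = σ ^ 2 * dispersionCoeff ν n σ := by
      rw [← sum_antidiagonal_gapCoeff h0 h1, Finset.mul_sum]
      exact Finset.sum_congr rfl fun p _ => by ring
    rw [e1, ← iteratedDeriv_radicand_critical h0]
    have hev : (fun s => radicand ν σ (Real.exp s)) =ᶠ[𝓝 (Real.log ν)]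
        energy ν σ * energy ν σ := by
      have hc : ContinuousAt (fun s => radicand ν σ (Real.exp s)) (Real.log ν) := by
        unfold radicand; fun_prop
      have : 0 < radicand ν σ (Real.exp (Real.log ν)) := by
        rw [Real.exp_log h0]; exact radicand_self_pos h0 h1 hσ
      filter_upwards [hc.eventually (lt_mem_nhds this)] with s hs
      exact (Real.mul_self_sqrt hs.le).symm
    rw [hev.iteratedDeriv_eq n, iteratedDeriv_mul (contDiffAt_energy h0 h1 hσ _)
      (contDiffAt_energy h0 h1 hσ _), Finset.sum_div, Finset.mul_sum,
      Finset.Nat.sum_antidiagonal_eq_sum_range_succ (fun i j =>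
        σ ^ i * (iteratedDeriv i (energy ν σ) (Real.log ν) / i.factorial) *
        (σ ^ j * (iteratedDeriv j (energy ν σ) (Real.log ν) / j.factorial)))]
    refine Finset.sum_congr rfl fun i hi => ?_
    have hi : i ≤ n := Nat.lt_succ_iff.1 (Finset.mem_range.1 hi)
    rw [Nat.cast_choose ℝ hi]
    conv_rhs => rw [← Nat.add_sub_cancel' hi, pow_add, Nat.add_sub_cancel' hi]
    have := Nat.factorial_ne_zero n
    field_simp
  rcases mul_self_eq_mul_self_iff.1 hPP with h | h
  · exact h
  · exfalso
    have := congrArg (PowerSeries.coeff 0) h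
    rw [map_neg, hP, hQ, PowerSeries.coeff_mk, PowerSeries.coeff_mk] at this
    simp at this
    nlinarith [mul_pos hσ (gapCoeff_zero_pos h0 h1 σ)]

/-! ### Asymptotics of the critical cumulants -/

section Cumulants

variable {w μ : ℝ}

theorem topEigenvalue_eq (hw : 0 < w) (L : ℕ) (s : ℝ) :
    topEigenvalue w μ L (Real.exp s) / L = -(μ + w) * L / L +
      ∑ j ∈ Finset.range L, w / L * energy (1 - μ / w) (sinHalf L j) s := by
  rw [topEigenvalue, add_div, Finset.sum_div]
  congr 1
  refine Finset.sum_congr rfl fun j _ => ?_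
  rw [dispersion_eq hw.ne', Real.sqrt_mul (sq_nonneg w), Real.sqrt_sq hw.le, energy]
  ring

theorem contDiffAt_topEigenvalue (hμ : 0 < μ) (hμw : μ < w) (L : ℕ) (n : WithTop ℕ∞) :
    ContDiffAt ℝ n (fun s => topEigenvalue w μ L (Real.exp s) / L) (criticalPoint w μ) := by
  have hw := hμ.trans hμw
  have h0 : 0 < 1 - μ / w := by rw [sub_pos, div_lt_one hw]; exact hμw
  have h1 : 1 - μ / w < 1 := by have : 0 < μ / w := by positivity
                                linarith
  simp only [topEigenvalue_eq hw]
  refine contDiffAt_const.add (ContDiffAt.sum fun j hj => contDiffAt_const.mul ?_)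
  exact contDiffAt_energy h0 h1 (sinHalf_pos (Finset.mem_range.1 hj)) n

theorem iteratedDeriv_topEigenvalue (hμ : 0 < μ) (hμw : μ < w) (L : ℕ) {n : ℕ} (hn : 1 ≤ n) :
    iteratedDeriv n (fun s => topEigenvalue w μ L (Real.exp s) / L) (criticalPoint w μ) =
      w * n.factorial * ((∑ j ∈ Finset.range L,
        (sinHalf L j)⁻¹ ^ (n - 1) * gapCoeff (1 - μ / w) n (sinHalf L j)) / L) := by
  have hw := hμ.trans hμw
  have h0 : 0 < 1 - μ / w := by rw [sub_pos, div_lt_one hw]; exact hμw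
  have h1 : 1 - μ / w < 1 := by have : 0 < μ / w := by positivity
                                linarith
  simp only [topEigenvalue_eq hw]
  rw [iteratedDeriv_const_add (by omega), iteratedDeriv_fun_sum]
  · rw [Finset.sum_div, Finset.mul_sum]
    refine Finset.sum_congr rfl fun j hj => ?_
    have hσ := sinHalf_pos (Finset.mem_range.1 hj)
    rw [iteratedDeriv_const_mul_field, criticalPoint]
    have h := iteratedDeriv_energy h0 h1 hσ n
    obtain ⟨m, rfl⟩ : ∃ m, n = m + 1 := ⟨n - 1, by omega⟩
    have hf := Nat.factorial_ne_zero (m + 1)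
    have h3 : gapCoeff (1 - μ / w) (m + 1) (sinHalf L j) = sinHalf L j ^ m *
      (iteratedDeriv (m + 1) (energy (1 - μ / w) (sinHalf L j)) (Real.log (1 - μ / w))
        / (m + 1).factorial) := by
      refine mul_left_cancel₀ hσ.ne' ?_
      rw [← h]; ring
    rw [h3, Nat.add_sub_cancel, inv_pow]
    field_simp
  · intro j hj
    exact contDiffAt_const.mul (contDiffAt_energy h0 h1 (sinHalf_pos (Finset.mem_range.1 hj)) n)

theorem criticalPoint_neg (hμ : 0 < μ) (hμw : μ < w) : criticalPoint w μ < 0 := by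
  have hw := hμ.trans hμw
  have : 0 < μ / w := by positivity
  exact Real.log_neg (by rw [sub_pos, div_lt_one hw]; exact hμw) (by linarith)

/-- Since `s_c < 0`, the half-line `s < 0` is a neighbourhood of it, so a formula valid there
determines all derivatives. -/
theorem limitCGF_eventuallyEq (hμ : 0 < μ) (hμw : μ < w) {L : ℕ}
    (hlim : ∀ s < 0, limitCGF w μ L s = topEigenvalue w μ L (Real.exp s) / L) :
    limitCGF w μ L =ᶠ[𝓝 (criticalPoint w μ)] fun s => topEigenvalue w μ L (Real.exp s) / L :=
  (gt_mem_nhds (criticalPoint_neg hμ hμw)).mono hlim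

theorem analyticAt_limitCGF (hμ : 0 < μ) (hμw : μ < w) {L : ℕ}
    (hlim : ∀ s < 0, limitCGF w μ L s = topEigenvalue w μ L (Real.exp s) / L) :
    AnalyticAt ℝ (limitCGF w μ L) (criticalPoint w μ) :=
  ((contDiffAt_topEigenvalue hμ hμw L ⊤).congr_of_eventuallyEq
    (limitCGF_eventuallyEq hμ hμw hlim)).analyticAt

theorem criticalCumulant_eq (hμ : 0 < μ) (hμw : μ < w) {L : ℕ}
    (hlim : ∀ s < 0, limitCGF w μ L s = topEigenvalue w μ L (Real.exp s) / L)
    {n : ℕ} (hn : 1 ≤ n) :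
    criticalCumulant w μ n L = w * n.factorial * ((∑ j ∈ Finset.range L,
        (sinHalf L j)⁻¹ ^ (n - 1) * gapCoeff (1 - μ / w) n (sinHalf L j)) / L) := by
  rw [criticalCumulant, (limitCGF_eventuallyEq hμ hμw hlim).iteratedDeriv_eq,
    iteratedDeriv_topEigenvalue hμ hμw L hn]

theorem critical_ratio_mem {w μ : ℝ} (hμ : 0 < μ) (hμw : μ < w) :
    0 < 1 - μ / w ∧ 1 - μ / w < 1 := by
  have hw := hμ.trans hμw
  have : 0 < μ / w := by positivity
  exact ⟨by rw [sub_pos, div_lt_one hw]; exact hμw, by linarith⟩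

theorem tendsto_even_cumulant_div (hμ : 0 < μ) (hμw : μ < w)
    (hlim : ∀ L, 2 ≤ L → ∀ s < 0, limitCGF w μ L s = topEigenvalue w μ L (Real.exp s) / L)
    (k : ℕ) :
    Tendsto (fun L => criticalCumulant w μ (2 * (k + 1)) L / invSinSum (2 * k + 1) L) atTop
      (𝓝 (w * (2 * (k + 1)).factorial * gapCoeff (1 - μ / w) (2 * (k + 1)) 0)) := by
  obtain ⟨h0, h1⟩ := critical_ratio_mem hμ hμw
  obtain ⟨M, hM⟩ := exists_bound_sub_zero (contDiff_gapCoeff h0 h1 (2 * (k + 1)))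
  have h := (tendsto_weighted_ratio (p := 2 * k) fun σ hσ => hM σ ⟨hσ.1.le, hσ.2⟩).const_mul
    (w * (2 * (k + 1)).factorial)
  refine h.congr' ?_
  filter_upwards [eventually_ge_atTop 2] with L hL
  rw [criticalCumulant_eq hμ hμw (hlim L hL) (by omega), show 2 * (k + 1) - 1 = 2 * k + 1 by omega,
    mul_div_assoc]

/-- The odd coefficient vanishes at `σ = 0`, so one of the inverse powers is absorbed into `σ⁻¹ *
gapCoeff`, whose limit is the derivative. The normalising sum is the one of the preceding even
order. -/
theorem tendsto_odd_cumulant_div (hμ : 0 < μ) (hμw : μ < w)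
    (hlim : ∀ L, 2 ≤ L → ∀ s < 0, limitCGF w μ L s = topEigenvalue w μ L (Real.exp s) / L)
    (k : ℕ) :
    Tendsto (fun L => criticalCumulant w μ (2 * (k + 1) + 1) L / invSinSum (2 * k + 1) L) atTop
      (𝓝 (w * (2 * (k + 1) + 1).factorial * deriv (gapCoeff (1 - μ / w) (2 * (k + 1) + 1)) 0)) := by
  obtain ⟨h0, h1⟩ := critical_ratio_mem hμ hμw
  set a := gapCoeff (1 - μ / w) (2 * (k + 1) + 1) with ha
  obtain ⟨M, hM⟩ := exists_bound_sub_linear (contDiff_gapCoeff h0 h1 (2 * (k + 1) + 1))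
  rw [gapCoeff_odd_zero h0 h1, ← ha] at hM
  have h := (tendsto_weighted_ratio (p := 2 * k) (h := fun σ => σ⁻¹ * a σ) (c := deriv a 0) (M := M)
    fun σ hσ => by
      have h2 := hM σ ⟨hσ.1.le, hσ.2⟩
      have hσ' := hσ.1
      have e : σ⁻¹ * a σ - deriv a 0 = (a σ - 0 - deriv a 0 * σ) * σ⁻¹ := by field_simp; ring
      rw [e, abs_mul, abs_of_pos (inv_pos.2 hσ'), ← div_eq_mul_inv, div_le_iff₀ hσ']
      linarith [h2, (by ring : M * σ * σ = M * σ ^ 2)]).const_mul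
    (w * (2 * (k + 1) + 1).factorial)
  refine h.congr' ?_
  filter_upwards [eventually_ge_atTop 2] with L hL
  rw [criticalCumulant_eq hμ hμw (hlim L hL) (by omega), mul_div_assoc]
  congr 3
  refine Finset.sum_congr rfl fun j _ => ?_
  rw [show 2 * (k + 1) + 1 - 1 = 2 * k + 1 + 1 by omega, pow_succ _ (2 * k + 1)]
  ring

theorem tendsto_abs_atTop_of_div {f T : ℕ → ℝ} {c : ℝ} (hc : c ≠ 0)
    (h : Tendsto (fun L => f L / T L) atTop (𝓝 c)) (hT : Tendsto T atTop atTop) :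
    Tendsto (fun L => |f L|) atTop atTop := by
  refine (h.abs.pos_mul_atTop (abs_pos.2 hc) hT).congr' ?_
  filter_upwards [hT.eventually_gt_atTop 0] with L hL
  rw [abs_div, abs_of_pos hL, div_mul_cancel₀ _ hL.ne']

theorem tendsto_even_scaled (hμ : 0 < μ) (hμw : μ < w)
    (hlim : ∀ L, 2 ≤ L → ∀ s < 0, limitCGF w μ L s = topEigenvalue w μ L (Real.exp s) / L)
    {m : ℕ} (hm : 2 ≤ m) :
    Tendsto (fun L : ℕ => (L : ℝ) ^ (2 - ((2 * m : ℕ) : ℤ)) * criticalCumulant w μ (2 * m) L)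
        atTop (𝓝 (2 * w * kappaStarEven (1 - μ / w) m)) := by
  obtain ⟨h0, h1⟩ := critical_ratio_mem hμ hμw
  obtain ⟨k, rfl⟩ : ∃ k, m = k + 1 := ⟨m - 1, by omega⟩
  have hν : 0 < 1 - (1 - μ / w) ^ 2 := by nlinarith
  -- Here `m = k + 1 ≥ 2` gives `2 * k ≥ 1`, so that the limiting series over `j` has exponent at
  -- least `2` and converges.
  have h := (tendsto_even_cumulant_div hμ hμw hlim k).mul
    (tendsto_invSinSum_scaled (p := 2 * k) (by omega))
  convert h.congr' ?_ using 2
  · rw [tsum_inv_odd_pow (by omega), gapCoeff_even_zero h0 h1, kappaStarEven, alpha, betaEven]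
    set ν := 1 - μ / w
    have hz : (2 * ((k + 1 : ℕ) : ℂ) - 1) = ((2 * k + 1 : ℕ) : ℂ) := by push_cast; ring
    have hr : (1 - ν ^ 2) ^ (((k + 1 : ℕ) : ℝ) - 1 / 2) =
        (1 - ν ^ 2) ^ (k + 1) / Real.sqrt (1 - ν ^ 2) := by
      rw [Real.rpow_sub hν, Real.rpow_natCast, Real.sqrt_eq_rpow]
    have ht : (2 : ℝ) ^ (1 - 2 * ((k + 1 : ℕ) : ℤ)) = (1 / 2) ^ (2 * k + 1) := by
      rw [show 1 - 2 * ((k + 1 : ℕ) : ℤ) = -((2 * k + 1 : ℕ) : ℤ) by push_cast; ring,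
        zpow_neg, zpow_natCast, one_div, inv_pow]
    rw [hz, hr, ht, show 2 * (k + 1) - 1 = 2 * k + 1 by omega, div_pow 2 Real.pi,
      div_pow 1, one_pow, div_pow (ν ^ 2), mul_pow 4]
    have hs := Real.sqrt_pos.2 hν
    have hp := Real.pi_pos
    have h4 : (4 : ℝ) ^ (k + 1) = 2 ^ (2 * k + 1) * 2 := by
      rw [← pow_succ, show 2 * k + 1 + 1 = 2 * (k + 1) by ring, pow_mul]; norm_num
    rw [h4, ← pow_mul]
    field_simp
  · filter_upwards [(tendsto_invSinSum_atTop (Nat.le_add_left 1 (2 * k))).eventually_gt_atTop 0,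
      eventually_gt_atTop 0] with L hT hL
    have hL' : (0 : ℝ) < L := by exact_mod_cast hL
    rw [show (2 - ((2 * (k + 1) : ℕ) : ℤ)) = -((2 * k : ℕ) : ℤ) by push_cast; ring, zpow_neg,
      zpow_natCast]
    field_simp

theorem tendsto_odd_scaled (hμ : 0 < μ) (hμw : μ < w)
    (hlim : ∀ L, 2 ≤ L → ∀ s < 0, limitCGF w μ L s = topEigenvalue w μ L (Real.exp s) / L)
    {n : ℕ} (hn : 3 ≤ n) (hodd : Odd n) :
    Tendsto (fun L : ℕ => (L : ℝ) ^ (2 - (n : ℤ)) * criticalCumulant w μ n L) atTop (𝓝 0) := by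
  obtain ⟨m, rfl⟩ := hodd
  obtain ⟨k, rfl⟩ : ∃ k, m = k + 1 := ⟨m - 1, by omega⟩
  have h := (tendsto_odd_cumulant_div hμ hμw hlim k).mul
    (tendsto_invSinSum_div_pow (p := 2 * k + 1) (by omega))
  rw [mul_zero] at h
  refine h.congr' ?_
  filter_upwards [(tendsto_invSinSum_atTop (Nat.le_add_left 1 (2 * k))).eventually_gt_atTop 0,
    eventually_gt_atTop 0] with L hT hL
  have hL' : (0 : ℝ) < L := by exact_mod_cast hL
  rw [show (2 - ((2 * (k + 1) + 1 : ℕ) : ℤ)) = -((2 * k + 1 : ℕ) : ℤ) by push_cast; ring, zpow_neg,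
    zpow_natCast]
  field_simp

theorem cumulants_of_limitCGF_eq (hμ : 0 < μ) (hμw : μ < w)
    (hlim : ∀ L, 2 ≤ L → ∀ s < 0, limitCGF w μ L s = topEigenvalue w μ L (Real.exp s) / L) :
    (∀ k : ℕ, 1 ≤ k →
      Tendsto (fun L : ℕ => |criticalCumulant w μ (2 * k) L|) atTop atTop ∧
      Tendsto (fun L : ℕ => |criticalCumulant w μ (2 * k + 1) L|) atTop atTop ∧
      (fun L : ℕ => criticalCumulant w μ (2 * k + 1) L) =Θ[atTop]
        (fun L : ℕ => criticalCumulant w μ (2 * k) L)) ∧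
    (∀ n : ℕ, 3 ≤ n → Odd n →
      Tendsto (fun L : ℕ => (L : ℝ) ^ (2 - (n : ℤ)) * criticalCumulant w μ n L)
        atTop (𝓝 0)) ∧
    (∀ n m : ℕ, 3 ≤ n → n = 2 * m →
      Tendsto (fun L : ℕ => (L : ℝ) ^ (2 - (n : ℤ)) * criticalCumulant w μ n L)
        atTop (𝓝 (2 * w * kappaStarEven (1 - μ / w) m))) := by
  obtain ⟨h0, h1⟩ := critical_ratio_mem hμ hμw
  have hw := hμ.trans hμw
  refine ⟨fun k hk => ?_, fun n hn ho => tendsto_odd_scaled hμ hμw hlim hn ho, ?_⟩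
  · obtain ⟨k, rfl⟩ : ∃ j, k = j + 1 := ⟨k - 1, by omega⟩
    have hT := tendsto_invSinSum_atTop (Nat.le_add_left 1 (2 * k))
    have he := tendsto_even_cumulant_div hμ hμw hlim k
    have ho := tendsto_odd_cumulant_div hμ hμw hlim k
    have hce : w * (2 * (k + 1)).factorial * gapCoeff (1 - μ / w) (2 * (k + 1)) 0 ≠ 0 :=
      mul_ne_zero (by positivity) (gapCoeff_even_zero_ne_zero h0 h1 _)
    have hco : w * (2 * (k + 1) + 1).factorial
        * deriv (gapCoeff (1 - μ / w) (2 * (k + 1) + 1)) 0 ≠ 0 :=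
      mul_ne_zero (by positivity) (deriv_gapCoeff_odd_zero_ne_zero h0 h1 hk)
    refine ⟨tendsto_abs_atTop_of_div hce he hT, tendsto_abs_atTop_of_div hco ho hT, ?_⟩
    exact (isTheta_of_div_tendsto_nhds_ne_zero ho hco).symm.trans
      (isTheta_of_div_tendsto_nhds_ne_zero he hce)
  · rintro n m hn rfl
    exact tendsto_even_scaled hμ hμw hlim (by omega)

end Cumulants

/-! ### Jordan–Wigner fermions and pair states -/

section Ladder

variable {L : ℕ}

theorem natCast_inj_of_lt {i j : ℕ} (hi : i < L) (hj : j < L) :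
    ((i : ZMod L) = (j : ZMod L)) ↔ i = j := by
  rw [ZMod.natCast_eq_natCast_iff', Nat.mod_eq_of_lt hi, Nat.mod_eq_of_lt hj]

/-- The configuration with the occupation number at the site `j` flipped. -/
def siteFlip (j : ℕ) (η : Config L) : Config L := Function.update η (j : ZMod L) (!η j)

/-- The Jordan–Wigner sign: the parity of the number of particles on the sites `0, …, k - 1`. -/
def jwSign (k : ℕ) (η : Config L) : ℝ :=
  ∏ i ∈ Finset.range k, if η (i : ZMod L) then (-1 : ℝ) else 1

theorem siteFlip_self (j : ℕ) (η : Config L) : siteFlip j η (j : ZMod L) = !η j := by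
  simp [siteFlip]

theorem siteFlip_of_ne {i j : ℕ} (hi : i < L) (hj : j < L) (h : i ≠ j) (η : Config L) :
    siteFlip j η (i : ZMod L) = η i := by
  simp [siteFlip, natCast_inj_of_lt hi hj, h]

theorem siteFlip_siteFlip (j : ℕ) (η : Config L) : siteFlip j (siteFlip j η) = η := by
  simp [siteFlip]

theorem siteFlip_comm {i j : ℕ} (hi : i < L) (hj : j < L) (h : i ≠ j) (η : Config L) :
    siteFlip i (siteFlip j η) = siteFlip j (siteFlip i η) := by
  have h1 : (i : ZMod L) ≠ j := fun e => h ((natCast_inj_of_lt hi hj).1 e)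
  simp only [siteFlip]
  rw [Function.update_of_ne h1, Function.update_of_ne h1.symm, Function.update_comm h1]

theorem jwSign_mul_self (k : ℕ) (η : Config L) : jwSign k η * jwSign k η = 1 := by
  rw [jwSign, ← Finset.prod_mul_distrib]
  exact Finset.prod_eq_one fun i _ => by split_ifs <;> norm_num

theorem jwSign_succ (k : ℕ) (η : Config L) :
    jwSign (k + 1) η = jwSign k η * if η (k : ZMod L) then (-1 : ℝ) else 1 := by
  rw [jwSign, Finset.prod_range_succ, jwSign]

theorem jwSign_siteFlip_of_le {k j : ℕ} (hk : k ≤ j) (hj : j < L) (η : Config L) :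
    jwSign k (siteFlip j η) = jwSign k η := by
  refine Finset.prod_congr rfl fun i hi => ?_
  have hi := Finset.mem_range.1 hi
  rw [siteFlip_of_ne (by omega) hj (by omega)]

theorem jwSign_siteFlip_of_lt {k j : ℕ} (hk : j < k) (hj : k ≤ L) (η : Config L) :
    jwSign k (siteFlip j η) = -jwSign k η := by
  induction k with
  | zero => omega
  | succ k ih =>
    rw [jwSign_succ, jwSign_succ]
    rcases Nat.lt_succ_iff_lt_or_eq.1 hk with h | rfl
    · rw [ih h (by omega), siteFlip_of_ne (by omega) (by omega) (by omega), neg_mul]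
    · rw [jwSign_siteFlip_of_le le_rfl (by omega), siteFlip_self]
      cases η (j : ZMod L) <;> simp

/-- The fermionic ladder operator at the site `k`: the creation operator for `b = true` and the
annihilation operator for `b = false`. -/
def ladder (k : ℕ) (b : Bool) : (Config L → ℝ) →ₗ[ℝ] (Config L → ℝ) where
  toFun f η := if η (k : ZMod L) = b then jwSign k η * f (siteFlip k η) else 0
  map_add' f g := by
    ext η
    simp only [Pi.add_apply]
    split_ifs <;> ring
  map_smul' c f := by
    ext η
    simp only [Pi.smul_apply, smul_eq_mul, RingHom.id_apply]
    split_ifs <;> ring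

theorem ladder_apply (k : ℕ) (b : Bool) (f : Config L → ℝ) (η : Config L) :
    ladder k b f η = if η (k : ZMod L) = b then jwSign k η * f (siteFlip k η) else 0 := rfl

/-- A flip at `i` reverses the sign string of `j > i`, while a flip at `j` leaves the string of `i`
alone. -/
theorem ladder_anticomm_of_lt {i j : ℕ} (hij : i < j) (hj : j < L) (b c : Bool)
    (f : Config L → ℝ) : ladder i b (ladder j c f) = -ladder j c (ladder i b f) := by
  ext η
  rw [Pi.neg_apply]
  simp only [ladder_apply]
  rw [siteFlip_of_ne hj (by omega) (by omega), siteFlip_of_ne (by omega) hj (by omega),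
    jwSign_siteFlip_of_le hij.le hj, jwSign_siteFlip_of_lt hij hj.le,
    siteFlip_comm (i := i) (j := j) (by omega) hj (by omega)]
  split_ifs <;> ring

theorem ladder_anticomm {i j : ℕ} (hi : i < L) (hj : j < L) (hij : i ≠ j) (b c : Bool)
    (f : Config L → ℝ) : ladder i b (ladder j c f) = -ladder j c (ladder i b f) := by
  rcases lt_or_gt_of_ne hij with h | h
  · exact ladder_anticomm_of_lt h hj b c f
  · rw [ladder_anticomm_of_lt h hi c b f, neg_neg]

theorem ladder_ladder_self (k : ℕ) (b : Bool) (f : Config L → ℝ) :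
    ladder k b (ladder k b f) = 0 := by
  ext η
  simp only [ladder_apply, siteFlip_self]
  cases b <;> cases η (k : ZMod L) <;> simp

theorem creation_anticomm {i j : ℕ} (hi : i < L) (hj : j < L) (b : Bool) (f : Config L → ℝ) :
    ladder i b (ladder j b f) = -ladder j b (ladder i b f) := by
  rcases eq_or_ne i j with rfl | h
  · rw [ladder_ladder_self, neg_zero]
  · exact ladder_anticomm hi hj h b b f

theorem annihilation_creation {i j : ℕ} (hi : i < L) (hj : j < L) (f : Config L → ℝ) :
    ladder i false (ladder j true f) =
      -ladder j true (ladder i false f) + if i = j then f else 0 := by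
  rcases eq_or_ne i j with rfl | h
  · ext η
    simp only [ladder_apply, siteFlip_self, siteFlip_siteFlip, if_true, Pi.add_apply, Pi.neg_apply]
    have h := jwSign_mul_self i η
    rw [jwSign_siteFlip_of_le le_rfl hi]
    cases hη : η (i : ZMod L) <;> simp [← mul_assoc, h]
  · rw [ladder_anticomm hi hj h, if_neg h, add_zero]

theorem creation_annihilation_self {i : ℕ} (hi : i < L) (f : Config L → ℝ) (η : Config L) :
    ladder i true (ladder i false f) η = occ η i * f η := by
  simp only [ladder_apply, siteFlip_self, siteFlip_siteFlip, jwSign_siteFlip_of_le le_rfl hi,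
    occ]
  have h := jwSign_mul_self i η
  cases hη : η (i : ZMod L) <;> simp [h, ← mul_assoc]

/-- The contraction of the annihilation operator at `i` with the pair creation operator at the
sites `e`. -/
def contraction (i : ℕ) (e : ℕ × ℕ) : (Config L → ℝ) →ₗ[ℝ] (Config L → ℝ) :=
  (if i = e.1 then ladder e.2 true else 0) - (if i = e.2 then ladder e.1 true else 0)

theorem pair_creation_comm {i j k : ℕ} (hi : i < L) (hj : j < L) (hk : k < L)
    (f : Config L → ℝ) : ladder i true (ladder j true (ladder k true f)) =
      ladder j true (ladder k true (ladder i true f)) := by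
  rw [creation_anticomm hi hj, creation_anticomm hi hk, map_neg, neg_neg]

theorem contraction_pair_creation {i j k : ℕ} {e : ℕ × ℕ} (h1 : e.1 < L) (h2 : e.2 < L)
    (hj : j < L) (hk : k < L) (f : Config L → ℝ) :
    contraction i e (ladder j true (ladder k true f)) =
      ladder j true (ladder k true (contraction i e f)) := by
  unfold contraction
  split_ifs <;> simp [pair_creation_comm, h1, h2, hj, hk]

/-- What remains of the contracted pair is one of its own creation operators, and these square to
zero. -/
theorem contraction_pair_creation_self {i j k : ℕ} (hj : j < L) (hk : k < L) (f : Config L → ℝ) :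
    contraction i (j, k) (ladder j true (ladder k true f)) = 0 := by
  unfold contraction
  have h1 : ladder j true (ladder j true (ladder k true f)) = 0 := ladder_ladder_self _ _ _
  have h2 : ladder k true (ladder j true (ladder k true f)) = 0 := by
    rw [creation_anticomm hk hj, ladder_ladder_self, map_zero, neg_zero]
  split_ifs <;> simp [h1, h2]

theorem annihilation_pair_creation {i j k : ℕ} (hi : i < L) (hj : j < L) (hk : k < L)
    (f : Config L → ℝ) : ladder i false (ladder j true (ladder k true f)) =
      ladder j true (ladder k true (ladder i false f)) + contraction i (j, k) f := by
  rw [annihilation_creation hi hj, annihilation_creation hi hk, contraction]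
  split_ifs <;> simp <;> abel

theorem continuous_ladder {X : Type*} [TopologicalSpace X] {φ : X → Config L → ℝ}
    (hφ : ∀ η, Continuous fun x => φ x η) (k : ℕ) (b : Bool) (η : Config L) :
    Continuous fun x => ladder k b (φ x) η := by
  simp only [ladder_apply]
  split_ifs
  · exact continuous_const.mul (hφ _)
  · exact continuous_const

/-- The state obtained from the empty configuration by applying the commuting operators
`1 + G e C_{e.1} C_{e.2}`. -/
theorem exists_pairState {X : Type*} [TopologicalSpace X] (s : Finset (ℕ × ℕ))
    (hs : ∀ e ∈ s, e.1 < L ∧ e.2 < L) {G : X → ℕ × ℕ → ℝ} (hG : ∀ e, Continuous fun x => G x e) :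
    ∃ ψ : X → Config L → ℝ, (∀ η, Continuous fun x => ψ x η) ∧ (∀ x, ψ x (emptyConfig L) = 1) ∧
      (∀ x η, jwSign L η ≠ 1 → ψ x η = 0) ∧
      ∀ x i, i < L → ladder i false (ψ x) = ∑ e ∈ s, G x e • contraction i e (ψ x) := by
  classical
  induction s using Finset.induction_on with
  | empty =>
    refine ⟨fun _ => Pi.single (emptyConfig L) 1, fun η => continuous_const, fun x => by simp,
      fun x η h => ?_, fun x i hi => ?_⟩
    · refine Pi.single_eq_of_ne ?_ _
      rintro rfl
      exact h (by simp [jwSign, emptyConfig])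
    · ext η
      simp only [ladder_apply, Finset.sum_empty, Pi.zero_apply]
      split_ifs with h
      · rw [Pi.single_eq_of_ne, mul_zero]
        intro h'
        have := congrFun h' (i : ZMod L)
        rw [siteFlip_self, h] at this
        simp [emptyConfig] at this
      · rfl
  | insert e s he ih =>
    obtain ⟨ψ, hc, h0, hodd, hD⟩ := ih fun e' he' => hs e' (Finset.mem_insert_of_mem he')
    obtain ⟨hj, hk⟩ := hs e (Finset.mem_insert_self _ _)
    refine ⟨fun x => ψ x + G x e • ladder e.1 true (ladder e.2 true (ψ x)), fun η => ?_,
      fun x => ?_,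
      fun x η h => ?_, fun x i hi => ?_⟩
    · exact (hc η).add ((hG e).mul (continuous_ladder (continuous_ladder hc _ _) _ _ _))
    · simp [h0, ladder_apply, emptyConfig]
    · have h2 : jwSign L (siteFlip e.2 (siteFlip e.1 η)) ≠ 1 := by
        rwa [jwSign_siteFlip_of_lt hk le_rfl, jwSign_siteFlip_of_lt hj le_rfl, neg_neg]
      simp [hodd x η h, ladder_apply, hodd x _ h2]
    -- Contractions of old pairs commute with the new factor. The new contraction does not see the
    -- new pair, so it may equally be applied to the enlarged state.
    · have e1 : ∀ e' ∈ s, contraction i e' (ψ x + G x e • ladder e.1 true (ladder e.2 true (ψ x))) =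
          contraction i e' (ψ x) + G x e • ladder e.1 true (ladder e.2 true
            (contraction i e' (ψ x))) := by
        intro e' he'
        obtain ⟨h1, h2⟩ := hs e' (Finset.mem_insert_of_mem he')
        rw [map_add, map_smul, contraction_pair_creation h1 h2 hj hk]
      rw [Finset.sum_insert he, Finset.sum_congr rfl fun e' he' => by rw [e1 e' he'], map_add,
        map_smul, map_add, map_smul, annihilation_pair_creation hi hj hk, hD x i hi,
        contraction_pair_creation_self hj hk]
      simp only [smul_add, smul_zero, add_zero, Finset.sum_add_distrib, map_sum, map_smul,
        Finset.smul_sum, smul_comm (G x e)]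
      abel

end Ladder

/-! ### Fourier sums over antiperiodic momenta -/

theorem sum_cos_eq_zero {L : ℕ} (φ : ℝ) {d : ℤ} (hd : ¬(L : ℤ) ∣ d) :
    ∑ k ∈ Finset.range L, Real.cos (φ + 2 * Real.pi * d * k / L) = 0 := by
  rcases Nat.eq_zero_or_pos L with rfl | hL
  · simp
  have hL' : (L : ℝ) ≠ 0 := by positivity
  have hs : Real.sin (Real.pi * d / L) ≠ 0 := by
    intro h
    obtain ⟨n, hn⟩ := Real.sin_eq_zero_iff.1 h
    rw [eq_div_iff hL'] at hn
    have h2 : (n : ℝ) * L = d := mul_right_cancel₀ Real.pi_ne_zero (by linarith)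
    exact hd ⟨n, by rw [mul_comm]; exact_mod_cast h2.symm⟩
  -- Multiplied by `2 sin (π d / L)`, the sum of cosines telescopes into sines, and the end terms
  -- agree by periodicity.
  have key := Finset.sum_range_sub
    (fun k : ℕ => Real.sin (φ + 2 * Real.pi * d * k / L - Real.pi * d / L)) L
  have e : ∀ k : ℕ, Real.sin (φ + 2 * Real.pi * d * (k + 1 : ℕ) / L - Real.pi * d / L) -
      Real.sin (φ + 2 * Real.pi * d * k / L - Real.pi * d / L) =
      2 * Real.sin (Real.pi * d / L) * Real.cos (φ + 2 * Real.pi * d * k / L) := by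
    intro k
    rw [Real.sin_sub_sin]
    congr 2
    · congr 1; push_cast; ring
    · push_cast; ring
  simp only [e] at key
  rw [← Finset.mul_sum, show φ + 2 * Real.pi * d * L / L - Real.pi * d / L =
    φ + 2 * Real.pi * d * (0 : ℕ) / L - Real.pi * d / L + d * (2 * Real.pi) by
      rw [mul_div_assoc, div_self hL']; push_cast; ring, Real.sin_add_int_mul_two_pi, sub_self]
    at key
  exact (mul_eq_zero.1 key).resolve_left (mul_ne_zero two_ne_zero hs)

/-- The antiperiodic Kronecker symbol as a Fourier sum over the antiperiodic momenta. -/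
def antiDelta (L : ℕ) (x : ℤ) : ℝ :=
  (∑ j ∈ Finset.range L, Real.cos (momentum L j * x)) / L

theorem momentum_mul_self {L : ℕ} (hL : 0 < L) (j : ℕ) :
    momentum L j * L = (2 * j + 1) * Real.pi := by
  have : (L : ℝ) ≠ 0 := by positivity
  unfold momentum; field_simp

theorem cos_momentum_mul_add {L : ℕ} (hL : 0 < L) (j : ℕ) (x : ℤ) :
    Real.cos (momentum L j * ((x + L : ℤ) : ℝ)) = -Real.cos (momentum L j * x) := by
  push_cast
  rw [mul_add, momentum_mul_self hL, show momentum L j * x + (2 * j + 1) * Real.pi =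
    momentum L j * x + Real.pi + j * (2 * Real.pi) by ring, Real.cos_add_nat_mul_two_pi,
    Real.cos_add_pi]

theorem sin_momentum_mul_add {L : ℕ} (hL : 0 < L) (j : ℕ) (x : ℤ) :
    Real.sin (momentum L j * ((x + L : ℤ) : ℝ)) = -Real.sin (momentum L j * x) := by
  push_cast
  rw [mul_add, momentum_mul_self hL, show momentum L j * x + (2 * j + 1) * Real.pi =
    momentum L j * x + Real.pi + j * (2 * Real.pi) by ring, Real.sin_add_nat_mul_two_pi,
    Real.sin_add_pi]

theorem antiDelta_zero {L : ℕ} (hL : 0 < L) : antiDelta L 0 = 1 := by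
  have : (L : ℝ) ≠ 0 := by positivity
  simp [antiDelta, this]

theorem antiDelta_add {L : ℕ} (hL : 0 < L) (x : ℤ) : antiDelta L (x + L) = -antiDelta L x := by
  simp only [antiDelta, cos_momentum_mul_add hL, Finset.sum_neg_distrib, neg_div]

theorem antiDelta_eq_zero {L : ℕ} {x : ℤ} (hx : ¬(L : ℤ) ∣ x) : antiDelta L x = 0 := by
  rw [antiDelta, div_eq_zero_iff]
  left
  rw [← sum_cos_eq_zero (Real.pi * x / L) hx]
  refine Finset.sum_congr rfl fun j _ => ?_
  congr 1
  unfold momentum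
  ring

/-- The function on `ℤ` with sine coefficients `c j` at the antiperiodic momenta. -/
def sineSum (L : ℕ) (c : ℕ → ℝ) (x : ℤ) : ℝ :=
  (∑ j ∈ Finset.range L, c j * Real.sin (momentum L j * x)) / L

theorem sineSum_neg (L : ℕ) (c : ℕ → ℝ) (x : ℤ) : sineSum L c (-x) = -sineSum L c x := by
  simp [sineSum, neg_div]

theorem sineSum_add {L : ℕ} (hL : 0 < L) (c : ℕ → ℝ) (x : ℤ) :
    sineSum L c (x + L) = -sineSum L c x := by
  simp only [sineSum, sin_momentum_mul_add hL, mul_neg, Finset.sum_neg_distrib, neg_div]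

/-- Product-to-sum leaves two resonances: equal momenta, and opposite momenta modulo `2π`, that is
`j = L - 1 - i`. -/
theorem sum_sin_mul_sin {L : ℕ} (hL : 0 < L) {i j : ℕ} (hi : i < L) (hj : j < L) (m n : ℤ) :
    ∑ k ∈ Finset.range L, Real.sin (momentum L i * ((k - m : ℤ) : ℝ))
      * Real.sin (momentum L j * ((k - n : ℤ) : ℝ)) =
    L / 2 * ((if i = j then Real.cos (momentum L i * ((m - n : ℤ) : ℝ)) else 0)
      - (if j = L - 1 - i then Real.cos (momentum L i * ((m - n : ℤ) : ℝ)) else 0)) := by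
  have hL' : (L : ℝ) ≠ 0 := by positivity
  have e : ∀ k : ℕ, Real.sin (momentum L i * ((k - m : ℤ) : ℝ))
      * Real.sin (momentum L j * ((k - n : ℤ) : ℝ)) =
      1 / 2 * (Real.cos (momentum L j * n - momentum L i * m
          + 2 * Real.pi * ((i - j : ℤ) : ℝ) * k / L) -
        Real.cos (-momentum L j * n - momentum L i * m
          + 2 * Real.pi * ((i + j + 1 : ℤ) : ℝ) * k / L)) := by
    intro k
    rw [show momentum L j * n - momentum L i * m + 2 * Real.pi * ((i - j : ℤ) : ℝ) * k / L =
        momentum L i * ((k - m : ℤ) : ℝ) - momentum L j * ((k - n : ℤ) : ℝ) by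
          unfold momentum; push_cast; ring,
      show -momentum L j * n - momentum L i * m + 2 * Real.pi * ((i + j + 1 : ℤ) : ℝ) * k / L =
        momentum L i * ((k - m : ℤ) : ℝ) + momentum L j * ((k - n : ℤ) : ℝ) by
          unfold momentum; push_cast; ring, Real.cos_sub, Real.cos_add]
    ring
  simp only [e]
  rw [← Finset.mul_sum, Finset.sum_sub_distrib]
  have h1 : ∑ k ∈ Finset.range L, Real.cos (momentum L j * n - momentum L i * m
          + 2 * Real.pi * ((i - j : ℤ) : ℝ) * k / L) =
      L * if i = j then Real.cos (momentum L i * ((m - n : ℤ) : ℝ)) else 0 := by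
    split_ifs with h
    · subst h
      have : ∀ k : ℕ, momentum L i * n - momentum L i * m + 2 * Real.pi * ((i - i : ℤ) : ℝ) * k / L
          = -(momentum L i * ((m - n : ℤ) : ℝ)) := fun k => by push_cast; ring
      simp only [this, Real.cos_neg]
      simp
    · rw [mul_zero]
      refine sum_cos_eq_zero _ fun hd => h ?_
      have := Int.eq_zero_of_abs_lt_dvd hd (by rw [abs_lt]; omega)
      omega
  have h2 : ∑ k ∈ Finset.range L, Real.cos (-momentum L j * n - momentum L i * m
          + 2 * Real.pi * ((i + j + 1 : ℤ) : ℝ) * k / L) =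
      L * if j = L - 1 - i then Real.cos (momentum L i * ((m - n : ℤ) : ℝ)) else 0 := by
    split_ifs with h
    · have hij : (j : ℝ) = L - 1 - i := by
        rw [h, Nat.cast_sub (by omega), Nat.cast_sub (by omega)]; simp
      have : ∀ k : ℕ, Real.cos (-momentum L j * n - momentum L i * m
          + 2 * Real.pi * ((i + j + 1 : ℤ) : ℝ) * k / L) =
          Real.cos (momentum L i * ((m - n : ℤ) : ℝ)) := fun k => by
        rw [← Real.cos_neg (momentum L i * ((m - n : ℤ) : ℝ)),
          ← Real.cos_add_int_mul_two_pi (-(momentum L i * ((m - n : ℤ) : ℝ))) (k - n)]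
        congr 1
        unfold momentum
        push_cast
        rw [hij]
        field_simp
        ring
      simp only [this]
      simp
    · rw [mul_zero]
      refine sum_cos_eq_zero _ fun hd => h ?_
      obtain ⟨c, hc⟩ := hd
      have h1 : (0 : ℤ) < L * c := by omega
      have h2 : (L : ℤ) * c < L * 2 := by omega
      have h3 : 0 < c := (mul_pos_iff_of_pos_left (by omega)).1 h1
      have h4 : c < 2 := lt_of_mul_lt_mul_left h2 (by omega)
      have h5 : c = 1 := by omega
      subst h5
      omega
  rw [h1, h2]
  ring

/-- Parseval for odd coefficients: oddness makes the two resonances add up instead of cancelling. -/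
theorem sum_sineSum_mul {L : ℕ} (hL : 0 < L) {c : ℕ → ℝ}
    (hc : ∀ j < L, c (L - 1 - j) = -c j) (m n : ℤ) :
    ∑ k ∈ Finset.range L, sineSum L c (k - m) * sineSum L c (k - n) =
      (∑ j ∈ Finset.range L, c j ^ 2 * Real.cos (momentum L j * ((m - n : ℤ) : ℝ))) / L := by
  have hL' : (L : ℝ) ≠ 0 := by positivity
  have e : ∀ k : ℕ, sineSum L c (k - m) * sineSum L c (k - n) =
      (∑ i ∈ Finset.range L, ∑ j ∈ Finset.range L, c i * c j *
        (Real.sin (momentum L i * ((k - m : ℤ) : ℝ))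
          * Real.sin (momentum L j * ((k - n : ℤ) : ℝ)))) / L ^ 2 := by
    intro k
    rw [sineSum, sineSum, div_mul_div_comm, Finset.sum_mul_sum, ← pow_two]
    congr 1
    exact Finset.sum_congr rfl fun i _ => Finset.sum_congr rfl fun j _ => by ring
  simp only [e]
  rw [← Finset.sum_div, Finset.sum_comm, div_eq_div_iff (by positivity) hL', Finset.sum_mul,
    Finset.sum_mul]
  refine Finset.sum_congr rfl fun i hi => ?_
  have hi := Finset.mem_range.1 hi
  rw [Finset.sum_comm]
  have e2 : ∀ j ∈ Finset.range L, ∑ k ∈ Finset.range L, c i * c j *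
        (Real.sin (momentum L i * ((k - m : ℤ) : ℝ))
          * Real.sin (momentum L j * ((k - n : ℤ) : ℝ))) =
      (if i = j then c i * c j * (L / 2) * Real.cos (momentum L i * ((m - n : ℤ) : ℝ)) else 0) -
      (if j = L - 1 - i then c i * c j * (L / 2) * Real.cos (momentum L i * ((m - n : ℤ) : ℝ))
        else 0) := by
    intro j hj
    rw [← Finset.mul_sum, sum_sin_mul_sin hL hi (Finset.mem_range.1 hj)]
    split_ifs <;> ring
  rw [Finset.sum_congr rfl e2, Finset.sum_sub_distrib, Finset.sum_ite_eq, Finset.sum_ite_eq',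
    if_pos (Finset.mem_range.2 hi), if_pos (Finset.mem_range.2 (by omega)), hc i hi]
  ring

/-! ### The pair amplitude and its Riccati equation -/

/-- The pair amplitude in momentum space. -/
def pairCoeff (w μ z q : ℝ) : ℝ :=
  (μ + 2 * w * z) * Real.sin q /
    (Real.sqrt (dispersion w μ z q) - ((μ + w * z) * Real.cos q - w))

theorem momentum_reflect {L j : ℕ} (h : j < L) :
    momentum L (L - 1 - j) = 2 * Real.pi - momentum L j := by
  have hL : (L : ℝ) ≠ 0 := by have : 0 < L := by omega
                              positivity
  unfold momentum
  rw [Nat.cast_sub (by omega), Nat.cast_sub (by omega)]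
  field_simp
  push_cast
  ring

theorem pairCoeff_reflect (w μ z : ℝ) {L j : ℕ} (h : j < L) :
    pairCoeff w μ z (momentum L (L - 1 - j)) = -pairCoeff w μ z (momentum L j) := by
  rw [momentum_reflect h, pairCoeff, pairCoeff, dispersion, dispersion, Real.cos_two_pi_sub,
    Real.sin_two_pi_sub, neg_sq, mul_neg, neg_div]

theorem cos_momentum_lt_one {L j : ℕ} (h : j < L) : Real.cos (momentum L j) < 1 := by
  have hs := sinHalf_pos h
  have hq : momentum L j = 2 * ((2 * j + 1) * Real.pi / (2 * L)) := by
    unfold momentum; rw [mul_div_assoc', mul_div_mul_left _ _ two_ne_zero]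
  rw [hq, Real.cos_two_mul, Real.cos_sq', ← sinHalf]
  nlinarith

/-- The root exceeds the subtracted term when `sin q ≠ 0`; at `cos q = -1` that term is negative.
Only `q = 0` could fail, and antiperiodic momenta avoid it. -/
theorem pairCoeff_denom_pos {w μ z q : ℝ} (hμ : 0 < μ) (hw : 0 < w) (hz : 0 ≤ z)
    (hq : Real.cos q < 1) :
    0 < Real.sqrt (dispersion w μ z q) - ((μ + w * z) * Real.cos q - w) := by
  rw [sub_pos]
  have hwz : 0 ≤ w * z := by positivity
  rcases eq_or_ne (Real.sin q) 0 with h | h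
  · have hc : Real.cos q = -1 := by
      have := Real.sin_sq_add_cos_sq q
      rw [h] at this
      nlinarith
    rw [hc]
    have := Real.sqrt_nonneg (dispersion w μ z q)
    linarith
  · refine Real.lt_sqrt_of_sq_lt ?_
    rw [dispersion]
    have : 0 < Real.sin q ^ 2 := by positivity
    have : 0 < μ * (μ + 2 * w * z) * Real.sin q ^ 2 := by positivity
    linarith

theorem dispersion_nonneg {w μ z : ℝ} (hμ : 0 < μ) (hw : 0 < w) (hz : 0 ≤ z) (q : ℝ) :
    0 ≤ dispersion w μ z q := by
  unfold dispersion; positivity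

theorem pairCoeff_mul_sin {w μ z q : ℝ} (hμ : 0 < μ) (hw : 0 < w) (hz : 0 ≤ z)
    (hq : Real.cos q < 1) :
    μ * (pairCoeff w μ z q * Real.sin q) =
      Real.sqrt (dispersion w μ z q) + ((μ + w * z) * Real.cos q - w) := by
  have hd := pairCoeff_denom_pos hμ hw hz hq
  have hs := Real.sq_sqrt (dispersion_nonneg hμ hw hz q)
  rw [pairCoeff, div_mul_eq_mul_div, mul_div_assoc', div_eq_iff hd.ne']
  have hdef : dispersion w μ z q = ((μ + w * z) * Real.cos q - w) ^ 2
    + μ * (μ + 2 * w * z) * Real.sin q ^ 2 := rfl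
  linear_combination -hs - hdef

theorem pairCoeff_riccati {w μ z q : ℝ} (hμ : 0 < μ) (hw : 0 < w) (hz : 0 ≤ z)
    (hq : Real.cos q < 1) :
    μ * pairCoeff w μ z q ^ 2 * Real.sin q =
      (μ + 2 * w * z) * Real.sin q + pairCoeff w μ z q * (2 * ((μ + w * z) * Real.cos q - w)) := by
  have hd := pairCoeff_denom_pos hμ hw hz hq
  have h := pairCoeff_mul_sin hμ hw hz hq
  have h2 : pairCoeff w μ z q * (Real.sqrt (dispersion w μ z q) -
      ((μ + w * z) * Real.cos q - w)) = (μ + 2 * w * z) * Real.sin q := by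
    rw [pairCoeff, div_mul_cancel₀ _ hd.ne']
  linear_combination pairCoeff w μ z q * h + h2

/-- The pair amplitude in position space. -/
def pairAmplitude (w μ : ℝ) (L : ℕ) (z : ℝ) (x : ℤ) : ℝ :=
  sineSum L (fun j => pairCoeff w μ z (momentum L j)) x

theorem continuous_pairAmplitude {w μ : ℝ} (hμ : 0 < μ) (hw : 0 < w) (L : ℕ) (x : ℤ) :
    Continuous fun z : Set.Ioc (0 : ℝ) 1 => pairAmplitude w μ L z x := by
  unfold pairAmplitude sineSum
  refine (continuous_finsetSum _ fun j hj => ?_).div_const _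
  refine Continuous.mul ?_ continuous_const
  unfold pairCoeff
  refine Continuous.div (by fun_prop) (by unfold dispersion; fun_prop) fun z => ?_
  exact (pairCoeff_denom_pos hμ hw z.2.1.le (cos_momentum_lt_one (Finset.mem_range.1 hj))).ne'

theorem sum_cos_momentum {L : ℕ} (hL : 2 ≤ L) :
    ∑ j ∈ Finset.range L, Real.cos (momentum L j) = 0 := by
  have hL' : (L : ℝ) ≠ 0 := by positivity
  have h := antiDelta_eq_zero (L := L) (x := 1) fun h => by
    have := Int.le_of_dvd one_pos h
    omega
  rw [antiDelta, div_eq_zero_iff] at h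
  simpa using h.resolve_right hL'

/-- The right side is the scalar left by the generator on a pair state: the diagonal `-μ L`, and `μ
g(1)` for each bond on which a nearest-neighbour pair is annihilated, `g` being the amplitude. -/
theorem topEigenvalue_eq_pairAmplitude {w μ z : ℝ} (hμ : 0 < μ) (hw : 0 < w) (hz : 0 ≤ z)
    {L : ℕ} (hL : 2 ≤ L) :
    topEigenvalue w μ L z = -(μ * L) + μ * (L * pairAmplitude w μ L z 1) := by
  have hL' : (L : ℝ) ≠ 0 := by positivity
  rw [pairAmplitude, sineSum, mul_div_cancel₀ _ hL', Finset.mul_sum]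
  simp only [Int.cast_one, mul_one]
  rw [Finset.sum_congr rfl fun j hj => pairCoeff_mul_sin hμ hw hz
    (cos_momentum_lt_one (Finset.mem_range.1 hj)), Finset.sum_add_distrib, Finset.sum_sub_distrib,
    ← Finset.mul_sum, sum_cos_momentum hL, topEigenvalue]
  simp
  ring

/-- The coefficient of `C_m C_n` with `n - m = x` in the tilted generator applied to the pair
state. -/
def pairResidual (w μ : ℝ) (L : ℕ) (z : ℝ) (x : ℤ) : ℝ :=
  -μ * ((∑ j ∈ Finset.range L, pairCoeff w μ z (momentum L j) ^ 2
      * Real.cos (momentum L j * ((x - 1 : ℤ) : ℝ))) / L)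
    + (μ + 2 * w * z) * antiDelta L (x - 1)
    + (μ + w * z) * (pairAmplitude w μ L z (x - 1) + pairAmplitude w μ L z (x + 1))
    - 2 * w * pairAmplitude w μ L z x

/-- In each mode the odd part in `x` is a multiple of `sin (q x)` times the Riccati equation.
Evenness suffices, because creation operators anticommute. -/
theorem pairResidual_neg {w μ z : ℝ} (hμ : 0 < μ) (hw : 0 < w) (hz : 0 ≤ z) (L : ℕ) (x : ℤ) :
    pairResidual w μ L z (-x) = pairResidual w μ L z x := by
  simp only [pairResidual, antiDelta, pairAmplitude, sineSum]
  rw [← sub_eq_zero]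
  simp only [← mul_div_assoc, Finset.mul_sum, ← add_div, ← sub_div, ← Finset.sum_add_distrib,
    ← Finset.sum_sub_distrib]
  rw [Finset.sum_eq_zero, zero_div]
  intro j hj
  have hr := pairCoeff_riccati hμ hw hz (cos_momentum_lt_one (Finset.mem_range.1 hj))
  set q := momentum L j
  have e1 : q * ((-x - 1 : ℤ) : ℝ) = -(q * x + q) := by push_cast; ring
  have e2 : q * ((-x + 1 : ℤ) : ℝ) = -(q * x - q) := by push_cast; ring
  have e3 : q * ((-x : ℤ) : ℝ) = -(q * x) := by push_cast; ring
  have e4 : q * ((x - 1 : ℤ) : ℝ) = q * x - q := by push_cast; ring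
  have e5 : q * ((x + 1 : ℤ) : ℝ) = q * x + q := by push_cast; ring
  rw [e1, e2, e3, e4, e5]
  simp only [Real.cos_neg, Real.sin_neg, Real.cos_add, Real.cos_sub, Real.sin_add, Real.sin_sub]
  linear_combination 2 * Real.sin (q * x) * hr

/-! ### The pair state as an eigenvector of the tilted generator -/

/-- The tilted generator with fugacity `z = exp s` acting on functions of the configuration. -/
def tiltedGen (w μ : ℝ) (L : ℕ) (z : ℝ) (f : Config L → ℝ) (η : Config L) : ℝ :=
  ∑ k ∈ Finset.range L,
    ((μ + w * z * (occ η (k : ZMod L) + occ η ((k : ZMod L) + 1))) * f (flip (k : ZMod L) η)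
      - rate w μ η (k : ZMod L) * f η)

section Eigenvector

variable {L : ℕ}

/-- The ladder operators continued antiperiodically to the site `L`. -/
def antiLadder (k : ℕ) (b : Bool) : (Config L → ℝ) →ₗ[ℝ] (Config L → ℝ) :=
  if k = L then -ladder 0 b else ladder k b

theorem flip_eq_siteFlip {k l : ℕ} (hk : k < L) (hl : l < L) (hkl : k ≠ l)
    (h : (l : ZMod L) = (k : ZMod L) + 1) (η : Config L) :
    flip (k : ZMod L) η = siteFlip l (siteFlip k η) := by
  have hne : (l : ZMod L) ≠ k := fun e => hkl ((natCast_inj_of_lt hl hk).1 e).symm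
  funext j
  simp only [flip, siteFlip, ← h]
  rcases eq_or_ne j l with rfl | h1
  · simp [hne]
  · rcases eq_or_ne j k with rfl | h2
    · simp [h1]
    · simp [h1, h2]

theorem bond_eq_of_lt {k : ℕ} (hk : k + 1 < L) (w μ z : ℝ) (f : Config L → ℝ) (η : Config L) :
    (μ + w * z * (occ η (k : ZMod L) + occ η ((k : ZMod L) + 1))) * f (flip (k : ZMod L) η) =
      μ * ladder (k + 1) false (ladder k false f) η
      + (μ + 2 * w * z) * ladder k true (ladder (k + 1) true f) η
      + (μ + w * z) * (ladder k true (ladder (k + 1) false f) η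
        + ladder (k + 1) true (ladder k false f) η) := by
  have hc : ((k + 1 : ℕ) : ZMod L) = (k : ZMod L) + 1 := by push_cast; rfl
  rw [flip_eq_siteFlip (by omega) hk (by omega) hc, ← hc]
  simp only [ladder_apply, occ]
  rw [siteFlip_of_ne (i := k) (j := k + 1) (by omega) hk (by omega),
    siteFlip_of_ne (i := k + 1) (j := k) hk (by omega) (by omega),
    jwSign_siteFlip_of_lt (k := k + 1) (j := k) (by omega) hk.le,
    jwSign_siteFlip_of_le (k := k) (j := k + 1) (by omega) hk,
    siteFlip_comm (i := k) (j := k + 1) (by omega) hk (by omega), jwSign_succ]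
  have h := jwSign_mul_self k η
  cases h1 : η (k : ZMod L) <;> cases h2 : η ((k + 1 : ℕ) : ZMod L) <;>
    simp [-mul_eq_mul_left_iff]
  · linear_combination -μ * f (siteFlip (k + 1) (siteFlip k η)) * h
  · linear_combination -(μ + w * z) * f (siteFlip (k + 1) (siteFlip k η)) * h
  · linear_combination -(μ + w * z) * f (siteFlip (k + 1) (siteFlip k η)) * h
  · linear_combination -(μ + 2 * w * z) * f (siteFlip (k + 1) (siteFlip k η)) * h

/-- On the closing bond the sign string covers the whole ring and equals the total parity. Support
in the even sector fixes it, and the leftover minus sign is the antiperiodic boundary condition. -/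
theorem bond_eq_last {k : ℕ} (hL : 2 ≤ L) (hk : k + 1 = L) (w μ z : ℝ) {f : Config L → ℝ}
    (hf : ∀ η, jwSign L η ≠ 1 → f η = 0) (η : Config L) :
    (μ + w * z * (occ η (k : ZMod L) + occ η ((k : ZMod L) + 1))) * f (flip (k : ZMod L) η) =
      -μ * ladder 0 false (ladder k false f) η
      - (μ + 2 * w * z) * ladder k true (ladder 0 true f) η
      - (μ + w * z) * (ladder k true (ladder 0 false f) η
        + ladder 0 true (ladder k false f) η) := by
  have hc : ((0 : ℕ) : ZMod L) = (k : ZMod L) + 1 := by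
    rw [← Nat.cast_add_one, hk, ZMod.natCast_self, Nat.cast_zero]
  rw [flip_eq_siteFlip (by omega) (by omega) (by omega) hc, ← hc]
  have hS : jwSign L (siteFlip 0 (siteFlip k η)) =
      jwSign k η * if η (k : ZMod L) then (-1 : ℝ) else 1 := by
    rw [jwSign_siteFlip_of_lt (by omega) le_rfl, jwSign_siteFlip_of_lt (by omega) le_rfl, neg_neg,
      ← jwSign_succ, hk]
  have hf' : jwSign k η * (if η (k : ZMod L) then (-1 : ℝ) else 1) * f (siteFlip 0 (siteFlip k η))
      = f (siteFlip 0 (siteFlip k η)) := by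
    rw [← hS]
    by_cases h : jwSign L (siteFlip 0 (siteFlip k η)) = 1
    · rw [h, one_mul]
    · rw [hf _ h, mul_zero]
  simp only [ladder_apply, occ]
  rw [siteFlip_of_ne (i := k) (j := 0) (by omega) (by omega) (by omega),
    siteFlip_of_ne (i := 0) (j := k) (by omega) (by omega) (by omega),
    jwSign_siteFlip_of_lt (k := k) (j := 0) (by omega) (by omega),
    jwSign_siteFlip_of_le (k := 0) (j := k) (by omega) (by omega),
    siteFlip_comm (i := k) (j := 0) (by omega) (by omega) (by omega),
    show jwSign 0 η = 1 by simp [jwSign]]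
  revert hf'
  cases h1 : η (k : ZMod L) <;> cases h2 : η ((0 : ℕ) : ZMod L) <;>
    simp [-mul_eq_mul_left_iff] <;> intro h
  · linear_combination -μ * h
  · linear_combination -(μ + w * z) * h
  · linear_combination -(μ + w * z) * h
  · linear_combination -(μ + 2 * w * z) * h

theorem bond_eq {k : ℕ} (hL : 2 ≤ L) (hk : k < L) (w μ z : ℝ) {f : Config L → ℝ}
    (hf : ∀ η, jwSign L η ≠ 1 → f η = 0) (η : Config L) :
    (μ + w * z * (occ η (k : ZMod L) + occ η ((k : ZMod L) + 1))) * f (flip (k : ZMod L) η) =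
      μ * antiLadder (k + 1) false (ladder k false f) η
      + (μ + 2 * w * z) * ladder k true (antiLadder (k + 1) true f) η
      + (μ + w * z) * (ladder k true (antiLadder (k + 1) false f) η
        + antiLadder (k + 1) true (ladder k false f) η) := by
  unfold antiLadder
  split_ifs with h
  · rw [bond_eq_last hL h w μ z hf]
    simp
    ring
  · exact bond_eq_of_lt (by omega) w μ z f η

theorem sum_rate (w μ : ℝ) (η : Config L) : ∑ k ∈ Finset.range L, rate w μ η (k : ZMod L) =
    μ * L + 2 * w * ∑ k ∈ Finset.range L, occ η (k : ZMod L) := by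
  have h : ∑ k ∈ Finset.range L, occ η ((k : ZMod L) + 1) =
      ∑ k ∈ Finset.range L, occ η (k : ZMod L) := by
    have h1 := Finset.sum_range_succ (fun k : ℕ => occ η (k : ZMod L)) L
    have h2 := Finset.sum_range_succ' (fun k : ℕ => occ η (k : ZMod L)) L
    simp only [Nat.cast_add, Nat.cast_one, ZMod.natCast_self, Nat.cast_zero] at h1 h2
    linarith
  simp only [rate, Finset.sum_add_distrib, ← Finset.mul_sum, h]
  simp
  ring

theorem antiLadder_creation (hL : 0 < L) {k : ℕ} (hk : k ≤ L) (f : Config L → ℝ) :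
    antiLadder k true f = ∑ n ∈ Finset.range L, antiDelta L (n - k) • ladder n true f := by
  have key : ∀ k < L, ladder k true f =
      ∑ n ∈ Finset.range L, antiDelta L (n - k) • ladder n true f := by
    intro k hk
    rw [Finset.sum_eq_single_of_mem k (Finset.mem_range.2 hk), sub_self, antiDelta_zero hL,
      one_smul]
    intro n hn hne
    have hn := Finset.mem_range.1 hn
    rw [antiDelta_eq_zero, zero_smul]
    intro hd
    have := Int.eq_zero_of_abs_lt_dvd hd (by rw [abs_lt]; omega)
    omega
  unfold antiLadder
  split_ifs with h
  · subst h
    rw [LinearMap.neg_apply, key 0 hL, ← Finset.sum_neg_distrib]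
    refine Finset.sum_congr rfl fun n _ => ?_
    have := antiDelta_add hL (n - k)
    rw [sub_add_cancel] at this
    rw [Nat.cast_zero, sub_zero, this, neg_smul, neg_neg]
  · exact key k (by omega)

section PairState

variable {g : ℤ → ℝ} {ψ : Config L → ℝ} (hψ : ∀ i < L, ladder i false ψ =
  ∑ n ∈ Finset.range L, g (n - i) • ladder n true ψ) (hg : ∀ x, g (x + L) = -g x)

include hψ hg

theorem antiLadder_annihilation (hL : 0 < L) {k : ℕ} (hk : k ≤ L) :
    antiLadder k false ψ = ∑ n ∈ Finset.range L, g (n - k) • ladder n true ψ := by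
  unfold antiLadder
  split_ifs with h
  · subst h
    rw [LinearMap.neg_apply, hψ 0 hL, ← Finset.sum_neg_distrib]
    refine Finset.sum_congr rfl fun n _ => ?_
    have := hg (n - k)
    rw [sub_add_cancel] at this
    rw [Nat.cast_zero, sub_zero, this, neg_smul, neg_neg]
  · exact hψ k (by omega)

/-- The first annihilation becomes a sum of creations. Moving the second one through them leaves a
single contraction, at the neighbouring site, with amplitude `g 1`; on the closing bond two minus
signs cancel. -/
theorem antiLadder_annihilation_annihilation (hL : 0 < L) {k : ℕ} (hk : k < L) :
    antiLadder (k + 1) false (ladder k false ψ) = g 1 • ψ -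
      ∑ m ∈ Finset.range L, ∑ n ∈ Finset.range L,
        (g (m - k) * g (n - (k + 1 : ℕ))) • ladder m true (ladder n true ψ) := by
  have e : ∑ m ∈ Finset.range L, ∑ n ∈ Finset.range L,
        (g (m - k) * g (n - (k + 1 : ℕ))) • ladder m true (ladder n true ψ) =
      ∑ m ∈ Finset.range L, g (m - k) • ladder m true (antiLadder (k + 1) false ψ) := by
    refine Finset.sum_congr rfl fun m _ => ?_
    rw [antiLadder_annihilation hψ hg hL hk, map_sum, Finset.smul_sum]
    refine Finset.sum_congr rfl fun n _ => ?_
    rw [map_smul, smul_smul]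
  rw [e, hψ k hk, map_sum]
  unfold antiLadder
  split_ifs with h
  · have e2 : ∀ m ∈ Finset.range L, (-ladder 0 false) (g (m - k) • ladder m true ψ) =
        (if 0 = m then -g (m - k) • ψ else 0)
          - g (m - k) • ladder m true ((-ladder 0 false) ψ) := by
      intro m hm
      rw [LinearMap.neg_apply, LinearMap.neg_apply, map_smul,
        annihilation_creation hL (Finset.mem_range.1 hm)]
      split_ifs <;> simp
    rw [Finset.sum_congr rfl e2, Finset.sum_sub_distrib, Finset.sum_ite_eq,
      if_pos (Finset.mem_range.2 hL)]
    have := hg (((0 : ℕ) : ℤ) - k)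
    rw [show (((0 : ℕ) : ℤ) - k) + L = 1 by omega] at this
    rw [this]
  · have e2 : ∀ m ∈ Finset.range L, ladder (k + 1) false (g (m - k) • ladder m true ψ) =
        (if k + 1 = m then g (m - k) • ψ else 0)
          - g (m - k) • ladder m true (ladder (k + 1) false ψ) := by
      intro m hm
      rw [map_smul, annihilation_creation (by omega) (Finset.mem_range.1 hm)]
      split_ifs <;> simp
      abel
    rw [Finset.sum_congr rfl e2, Finset.sum_sub_distrib, Finset.sum_ite_eq,
      if_pos (Finset.mem_range.2 (by omega))]
    congr 3
    push_cast; ring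

theorem sum_creation_annihilation (hL : 0 < L) :
    ∑ k ∈ Finset.range L, antiLadder (k + 1) true (ladder k false ψ) =
      ∑ m ∈ Finset.range L, ∑ n ∈ Finset.range L,
        g (n - m + 1) • ladder m true (ladder n true ψ) := by
  set F : ℕ → Config L → ℝ := fun k => ∑ n ∈ Finset.range L,
    g (n - k + 1) • antiLadder k true (ladder n true ψ) with hF
  have h1 : ∀ k ∈ Finset.range L, antiLadder (k + 1) true (ladder k false ψ) = F (k + 1) := by
    intro k hk
    rw [hψ k (Finset.mem_range.1 hk), map_sum]
    refine Finset.sum_congr rfl fun n _ => ?_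
    rw [map_smul]
    congr 2
    push_cast; ring
  have h2 : ∀ k ∈ Finset.range L, F k = ∑ n ∈ Finset.range L,
      g (n - k + 1) • ladder k true (ladder n true ψ) := by
    intro k hk
    have := Finset.mem_range.1 hk
    refine Finset.sum_congr rfl fun n _ => ?_
    rw [antiLadder, if_neg (by omega)]
  -- The signs from the antiperiodic ladder and from the antiperiodic `g` cancel, so the sum may be
  -- shifted around the ring.
  have h3 : F L = F 0 := by
    refine Finset.sum_congr rfl fun n _ => ?_
    rw [antiLadder, if_pos rfl, antiLadder, if_neg (by omega), LinearMap.neg_apply]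
    have := hg (n - L + 1)
    rw [show (n : ℤ) - L + 1 + L = n - (0 : ℕ) + 1 by push_cast; ring] at this
    rw [this, neg_smul, smul_neg]
  have h4 := Finset.sum_range_succ F L
  rw [Finset.sum_range_succ', h3] at h4
  rw [Finset.sum_congr rfl h1, add_right_cancel h4, Finset.sum_congr rfl h2]

end PairState

theorem sum_symm_creation_eq_zero {Q : ℤ → ℝ} (hQ : ∀ x, Q (-x) = Q x) (ψ : Config L → ℝ)
    (η : Config L) : ∑ m ∈ Finset.range L, ∑ n ∈ Finset.range L,
      Q (n - m) * ladder m true (ladder n true ψ) η = 0 := by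
  have h : ∑ m ∈ Finset.range L, ∑ n ∈ Finset.range L,
      Q (n - m) * ladder m true (ladder n true ψ) η = -∑ m ∈ Finset.range L, ∑ n ∈ Finset.range L,
      Q (n - m) * ladder m true (ladder n true ψ) η := by
    conv_lhs => rw [Finset.sum_comm]
    rw [← Finset.sum_neg_distrib]
    refine Finset.sum_congr rfl fun m hm => ?_
    rw [← Finset.sum_neg_distrib]
    refine Finset.sum_congr rfl fun n hn => ?_
    rw [creation_anticomm (Finset.mem_range.1 hn) (Finset.mem_range.1 hm), ← hQ]
    simp
  linarith

theorem tiltedGen_pairState {w μ z : ℝ} (hμ : 0 < μ) (hw : 0 < w) (hz : 0 ≤ z) (hL : 2 ≤ L)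
    {ψ : Config L → ℝ} (hodd : ∀ η, jwSign L η ≠ 1 → ψ η = 0)
    (hψ : ∀ i < L, ladder i false ψ =
      ∑ n ∈ Finset.range L, pairAmplitude w μ L z (n - i) • ladder n true ψ) (η : Config L) :
    tiltedGen w μ L z ψ η = topEigenvalue w μ L z * ψ η := by
  have hL0 : 0 < L := by omega
  have hg : ∀ x, pairAmplitude w μ L z (x + L) = -pairAmplitude w μ L z x :=
    fun x => sineSum_add hL0 _ x
  set g := pairAmplitude w μ L z with hgdef
  set E : ℕ → ℕ → ℝ := fun m n => ladder m true (ladder n true ψ) η with hE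
  have h1 : ∀ k ∈ Finset.range L, antiLadder (k + 1) false (ladder k false ψ) η =
      g 1 * ψ η - ∑ m ∈ Finset.range L, ∑ n ∈ Finset.range L,
        g (m - k) * g (n - (k + 1 : ℕ)) * E m n := by
    intro k hk
    rw [antiLadder_annihilation_annihilation hψ hg hL0 (Finset.mem_range.1 hk)]
    simp [Finset.sum_apply, hE]
  have h2 : ∀ k ∈ Finset.range L, ladder k true (antiLadder (k + 1) true ψ) η =
      ∑ n ∈ Finset.range L, antiDelta L (n - k - 1) * E k n := by
    intro k hk
    rw [antiLadder_creation hL0 (Finset.mem_range.1 hk), map_sum, Finset.sum_apply]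
    refine Finset.sum_congr rfl fun n _ => ?_
    rw [map_smul, Pi.smul_apply, smul_eq_mul]
    push_cast
    rw [sub_add_eq_sub_sub]
  have h3 : ∀ k ∈ Finset.range L, ladder k true (antiLadder (k + 1) false ψ) η =
      ∑ n ∈ Finset.range L, g (n - k - 1) * E k n := by
    intro k hk
    rw [antiLadder_annihilation hψ hg hL0 (Finset.mem_range.1 hk), map_sum, Finset.sum_apply]
    refine Finset.sum_congr rfl fun n _ => ?_
    rw [map_smul, Pi.smul_apply, smul_eq_mul]
    push_cast
    rw [sub_add_eq_sub_sub]
  have h4 : ∑ k ∈ Finset.range L, antiLadder (k + 1) true (ladder k false ψ) η =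
      ∑ m ∈ Finset.range L, ∑ n ∈ Finset.range L, g (n - m + 1) * E m n := by
    have := congrFun (sum_creation_annihilation hψ hg hL0) η
    simpa [Finset.sum_apply] using this
  have h5 : ∀ k ∈ Finset.range L, occ η (k : ZMod L) * ψ η =
      ∑ n ∈ Finset.range L, g (n - k) * E k n := by
    intro k hk
    rw [← creation_annihilation_self (Finset.mem_range.1 hk), hψ k (Finset.mem_range.1 hk),
      map_sum, Finset.sum_apply]
    refine Finset.sum_congr rfl fun n _ => ?_
    rw [map_smul, Pi.smul_apply, smul_eq_mul]
  have h6 : ∑ k ∈ Finset.range L, ∑ m ∈ Finset.range L, ∑ n ∈ Finset.range L,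
        g (m - k) * g (n - (k + 1 : ℕ)) * E m n =
      ∑ m ∈ Finset.range L, ∑ n ∈ Finset.range L, (∑ j ∈ Finset.range L,
        pairCoeff w μ z (momentum L j) ^ 2
          * Real.cos (momentum L j * ((n - m - 1 : ℤ) : ℝ))) / L * E m n := by
    rw [Finset.sum_comm]
    refine Finset.sum_congr rfl fun m _ => ?_
    rw [Finset.sum_comm]
    refine Finset.sum_congr rfl fun n _ => ?_
    rw [← Finset.sum_mul]
    congr 1
    have hc := sum_sineSum_mul hL0 (c := fun j => pairCoeff w μ z (momentum L j))
      (fun j hj => pairCoeff_reflect w μ z hj) m (n - 1)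
    have e : ∀ k : ℕ, g (m - k) * g (n - (k + 1 : ℕ)) =
        sineSum L (fun j => pairCoeff w μ z (momentum L j)) (k - m) *
        sineSum L (fun j => pairCoeff w μ z (momentum L j)) (k - (n - 1)) := by
      intro k
      rw [hgdef, pairAmplitude, pairAmplitude, ← neg_mul_neg, ← sineSum_neg, ← sineSum_neg]
      congr 2 <;> push_cast <;> ring
    rw [Finset.sum_congr rfl fun k _ => e k, hc]
    congr 1
    refine Finset.sum_congr rfl fun j _ => ?_
    rw [← Real.cos_neg]
    congr 2
    push_cast; ring
  -- All terms with two creation operators collect into `pairResidual`, so this identity removes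
  -- everything except the scalar part.
  have h7 := sum_symm_creation_eq_zero (pairResidual_neg hμ hw hz L) ψ η
  have h8 : tiltedGen w μ L z ψ η = ∑ k ∈ Finset.range L,
      (μ * antiLadder (k + 1) false (ladder k false ψ) η
      + (μ + 2 * w * z) * ladder k true (antiLadder (k + 1) true ψ) η
      + (μ + w * z) * (ladder k true (antiLadder (k + 1) false ψ) η
        + antiLadder (k + 1) true (ladder k false ψ) η)) -
      (μ * L * ψ η + 2 * w * ∑ k ∈ Finset.range L, occ η (k : ZMod L) * ψ η) := by
    rw [tiltedGen, Finset.sum_sub_distrib, ← Finset.sum_mul, sum_rate, add_mul, ← Finset.sum_mul]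
    rw [Finset.sum_congr rfl fun k hk => bond_eq hL (Finset.mem_range.1 hk) w μ z hodd η]
    ring
  rw [h8, topEigenvalue_eq_pairAmplitude hμ hw hz hL]
  simp only [Finset.sum_add_distrib, ← Finset.mul_sum, h4]
  rw [Finset.sum_congr rfl h1, Finset.sum_congr rfl h2, Finset.sum_congr rfl h3,
    Finset.sum_congr rfl h5, Finset.sum_sub_distrib, h6]
  simp only [pairResidual, add_mul, sub_mul, Finset.sum_add_distrib, Finset.sum_sub_distrib,
    mul_add, mul_assoc, ← Finset.mul_sum] at h7
  simp only [Finset.sum_const, Finset.card_range, nsmul_eq_mul]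
  linear_combination h7

end Eigenvector

/-! ### Irreducibility and positivity of the eigenvector -/

section Positivity

variable {L : ℕ}

theorem exists_eigenvectors {w μ : ℝ} (hμ : 0 < μ) (hw : 0 < w) (hL : 2 ≤ L) :
    ∃ ψ : Set.Ioc (0 : ℝ) 1 → Config L → ℝ, (∀ η, Continuous fun z => ψ z η) ∧
      (∀ z, ψ z (emptyConfig L) = 1) ∧ (∀ z η, jwSign L η ≠ 1 → ψ z η = 0) ∧
      ∀ (z : Set.Ioc (0 : ℝ) 1) η, tiltedGen w μ L z (ψ z) η = topEigenvalue w μ L z * ψ z η := by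
  obtain ⟨ψ, hc, h0, hodd, hD⟩ := exists_pairState (L := L) (X := Set.Ioc (0 : ℝ) 1)
    (Finset.range L ×ˢ Finset.range L)
    (fun e he => by simpa using he)
    -- The product runs over ordered pairs. The factor `1/2` compensates for the equal contributions
    -- of `(m, n)` and `(n, m)`, the amplitude being odd.
    (G := fun z e => 1 / 2 * pairAmplitude w μ L z ((e.2 : ℤ) - e.1))
    (fun e => continuous_const.mul (continuous_pairAmplitude hμ hw L _))
  refine ⟨ψ, hc, h0, hodd, fun z η => tiltedGen_pairState hμ hw z.2.1.le hL (hodd z) ?_ η⟩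
  intro i hi
  have hi' := Finset.mem_range.2 hi
  have e1 : ∀ m n : ℕ, (1 / 2 * pairAmplitude w μ L z ((n : ℤ) - m)) • contraction i (m, n) (ψ z) =
      (if i = m then (1 / 2 * pairAmplitude w μ L z ((n : ℤ) - m)) • ladder n true (ψ z) else 0) +
      (if i = n then (1 / 2 * pairAmplitude w μ L z ((m : ℤ) - n)) • ladder m true (ψ z)
        else 0) := by
    intro m n
    have hneg : pairAmplitude w μ L z ((n : ℤ) - m) = -pairAmplitude w μ L z ((m : ℤ) - n) := by
      rw [pairAmplitude, pairAmplitude, ← sineSum_neg, neg_sub]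
    unfold contraction
    split_ifs <;> simp [hneg, smul_sub]
  rw [hD z i hi, Finset.sum_product]
  simp only [e1, Finset.sum_add_distrib]
  rw [Finset.sum_comm]
  simp only [Finset.sum_ite_eq, if_pos hi']
  rw [← Finset.sum_add_distrib]
  refine Finset.sum_congr rfl fun n _ => ?_
  rw [← add_smul]
  congr 1
  ring

theorem exists_flip_eq (hL : 2 ≤ L) {k : ℕ} (hk : k < L) (η : Config L) :
    ∃ l < L, l ≠ k ∧ flip (k : ZMod L) η = siteFlip l (siteFlip k η) := by
  rcases eq_or_ne (k + 1) L with h | h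
  · refine ⟨0, by omega, by omega, flip_eq_siteFlip hk (by omega) (by omega) ?_ η⟩
    rw [← Nat.cast_add_one, h, ZMod.natCast_self, Nat.cast_zero]
  · exact ⟨k + 1, by omega, by omega, flip_eq_siteFlip hk (by omega) (by omega) (by simp) η⟩

theorem jwSign_flip (hL : 2 ≤ L) {k : ℕ} (hk : k < L) (η : Config L) :
    jwSign L (flip (k : ZMod L) η) = jwSign L η := by
  obtain ⟨l, hl, -, h⟩ := exists_flip_eq hL hk η
  rw [h, jwSign_siteFlip_of_lt hl le_rfl, jwSign_siteFlip_of_lt hk le_rfl, neg_neg]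

theorem flip_flip (k : ZMod L) (η : Config L) : flip k (flip k η) = η := by
  funext j
  simp only [flip]
  split_ifs <;> simp

theorem jwSign_emptyConfig (k : ℕ) : jwSign k (emptyConfig L) = 1 := by
  simp [jwSign, emptyConfig]

theorem pairFlip_of_flip_closed {P : Config L → Prop}
    (hP : ∀ η, ∀ k < L, P η → P (flip (k : ZMod L) η)) {j : ℕ} (hj : j + 1 < L) {η : Config L}
    (h : P η) : P (siteFlip (j + 1) (siteFlip 0 η)) := by
  induction j with
  | zero =>
    rw [← flip_eq_siteFlip (by omega) hj (by omega) (by simp)]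
    exact hP _ _ (by omega) h
  | succ j ih =>
    have h1 := hP _ (j + 1) (by omega) (ih (by omega))
    rw [flip_eq_siteFlip (by omega) hj (by omega) (by push_cast; rfl), siteFlip_siteFlip] at h1
    exact h1

/-- Each occupied site other than `0` is emptied together with a flip of site `0`, a composition of
bond flips. Even parity then forces site `0` to be empty as well. -/
theorem emptyConfig_of_flip_closed (hL : 2 ≤ L) {P : Config L → Prop}
    (hP : ∀ η, ∀ k < L, P η → P (flip (k : ZMod L) η)) {η : Config L} (hη : jwSign L η = 1)
    (h : P η) : P (emptyConfig L) := by
  have key : ∀ n, n < L → ∃ η', P η' ∧ jwSign L η' = 1 ∧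
      ∀ i < n, η' ((i + 1 : ℕ) : ZMod L) = false := by
    intro n
    induction n with
    | zero => exact fun _ => ⟨η, h, hη, fun i hi => absurd hi (by omega)⟩
    | succ n ih =>
      intro hn
      obtain ⟨η', h1, h2, h3⟩ := ih (by omega)
      cases h4 : η' ((n + 1 : ℕ) : ZMod L)
      · refine ⟨η', h1, h2, fun i hi => ?_⟩
        rcases Nat.lt_succ_iff_lt_or_eq.1 hi with hi | rfl
        · exact h3 i hi
        · exact h4
      · refine ⟨_, pairFlip_of_flip_closed hP hn h1, ?_, fun i hi => ?_⟩
        · rw [jwSign_siteFlip_of_lt hn le_rfl, jwSign_siteFlip_of_lt (by omega) le_rfl, neg_neg, h2]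
        · rcases Nat.lt_succ_iff_lt_or_eq.1 hi with hi | rfl
          · rw [siteFlip_of_ne (by omega) hn (by omega), siteFlip_of_ne (by omega) (by omega)
              (by omega), h3 i hi]
          · rw [siteFlip_self, siteFlip_of_ne hn (by omega) (by omega), h4, Bool.not_true]
  obtain ⟨η', h1, h2, h3⟩ := key (L - 1) (by omega)
  have h4 : η' ((0 : ℕ) : ZMod L) = false := by
    rw [jwSign, Finset.prod_eq_single_of_mem 0 (Finset.mem_range.2 (by omega))] at h2
    · cases h5 : η' ((0 : ℕ) : ZMod L)
      · rfl
      · rw [h5] at h2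
        norm_num at h2
    · intro i hi hne
      have hi := Finset.mem_range.1 hi
      have := h3 (i - 1) (by omega)
      rw [Nat.sub_add_cancel (by omega)] at this
      simp [this]
  have : η' = emptyConfig L := by
    have : NeZero L := ⟨by omega⟩
    funext j
    rw [← ZMod.natCast_zmod_val j]
    have hj := ZMod.val_lt j
    rcases Nat.eq_zero_or_pos j.val with h | h
    · rw [h, h4]; rfl
    · have := h3 (j.val - 1) (by omega)
      rw [Nat.sub_add_cancel (by omega)] at this
      rw [this]; rfl
  rwa [← this]

/-- Bond flips are involutions, so the complement of `P` is also closed; if it met the even sector,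
both would contain the empty configuration. -/
theorem forall_even_of_flip_closed (hL : 2 ≤ L) {P : Config L → Prop}
    (hP : ∀ η, ∀ k < L, P η → P (flip (k : ZMod L) η)) {η₀ η : Config L} (h₀ : jwSign L η₀ = 1)
    (h : P η₀) (hη : jwSign L η = 1) : P η := by
  by_contra hn
  refine emptyConfig_of_flip_closed (P := fun η => ¬P η) hL (fun η k hk h1 h2 => h1 ?_) hη hn
    (emptyConfig_of_flip_closed hL hP h₀ h)
  rw [← flip_flip (k : ZMod L) η]
  exact hP _ k hk h2

theorem occ_nonneg (η : Config L) (k : ZMod L) : 0 ≤ occ η k := by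
  unfold occ; split_ifs <;> norm_num

/-- At a zero the diagonal terms drop out and a sum of nonnegative terms vanishes, so the zero
spreads to all neighbours. The rates are positive because `μ > 0`. -/
theorem eq_zero_of_nonneg_eigenvector {w μ z c : ℝ} (hμ : 0 < μ) (hw : 0 < w) (hz : 0 ≤ z)
    (hL : 2 ≤ L) {f : Config L → ℝ} (hf : ∀ η, jwSign L η = 1 → 0 ≤ f η)
    (heig : ∀ η, jwSign L η = 1 → tiltedGen w μ L z f η = c * f η) {η₀ η : Config L}
    (h₀ : jwSign L η₀ = 1) (h : f η₀ = 0) (hη : jwSign L η = 1) : f η = 0 := by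
  refine (forall_even_of_flip_closed (P := fun η => jwSign L η = 1 ∧ f η = 0) hL ?_ h₀ ⟨h₀, h⟩
    hη).2
  rintro η k hk ⟨h1, h2⟩
  refine ⟨by rw [jwSign_flip hL hk, h1], ?_⟩
  have h3 := heig η h1
  rw [h2, mul_zero, tiltedGen] at h3
  have hr : ∀ i : ℕ, 0 < μ + w * z * (occ η (i : ZMod L) + occ η ((i : ZMod L) + 1)) := by
    intro i
    have := occ_nonneg η (i : ZMod L)
    have := occ_nonneg η ((i : ZMod L) + 1)
    positivity
  rw [Finset.sum_eq_zero_iff_of_nonneg] at h3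
  · have h4 := h3 k (Finset.mem_range.2 hk)
    rw [h2, mul_zero, sub_zero] at h4
    exact (mul_eq_zero.1 h4).resolve_left (hr k).ne'
  · intro i hi
    rw [h2, mul_zero, sub_zero]
    exact mul_nonneg (hr i).le (hf _ (by rw [jwSign_flip hL (Finset.mem_range.1 hi), h1]))

theorem tiltedGen_one_sub_const (w μ : ℝ) (f : Config L → ℝ) (a : ℝ) (η : Config L) :
    tiltedGen w μ L 1 (fun η => f η - a) η = tiltedGen w μ L 1 f η := by
  refine Finset.sum_congr rfl fun k _ => ?_
  rw [rate]
  ring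

/-- Without tilting, the dispersion is the perfect square of `μ + w - w cos q`, and the cosines sum
to zero. -/
theorem topEigenvalue_one {w μ : ℝ} (hμ : 0 < μ) (hw : 0 < w) (hL : 2 ≤ L) :
    topEigenvalue w μ L 1 = 0 := by
  have h : ∀ q, Real.sqrt (dispersion w μ 1 q) = μ + w - w * Real.cos q := by
    intro q
    rw [← Real.sqrt_sq (show 0 ≤ μ + w - w * Real.cos q by nlinarith [Real.cos_le_one q])]
    congr 1
    rw [dispersion, Real.sin_sq]
    ring
  simp only [topEigenvalue, h, Finset.sum_sub_distrib, ← Finset.mul_sum, sum_cos_momentum hL]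
  simp
  ring

/-- The Perron eigenvector of the tilted generator in the even sector. -/
theorem exists_positive_eigenvector {w μ : ℝ} (hμ : 0 < μ) (hw : 0 < w) (hL : 2 ≤ L) {z : ℝ}
    (hz0 : 0 < z) (hz1 : z ≤ 1) :
    ∃ ψ : Config L → ℝ, (∀ η, jwSign L η = 1 → 0 < ψ η) ∧ (∀ η, jwSign L η ≠ 1 → ψ η = 0) ∧
      ∀ η, tiltedGen w μ L z ψ η = topEigenvalue w μ L z * ψ η := by
  have : NeZero L := ⟨by omega⟩
  obtain ⟨ψ, hc, h0, hodd, heig⟩ := exists_eigenvectors (L := L) hμ hw hL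
  suffices h : ∀ z, ∀ η, jwSign L η = 1 → 0 < ψ z η from
    ⟨ψ ⟨z, hz0, hz1⟩, h _, hodd _, heig ⟨z, hz0, hz1⟩⟩
  -- The normalisation `ψ = 1` at the empty configuration rules out a zero of a nonnegative
  -- eigenvector. Hence the set of good `z` is both open and closed.
  have hS : {z | ∀ η, jwSign L η = 1 → 0 < ψ z η} = {z | ∀ η, jwSign L η = 1 → 0 ≤ ψ z η} := by
    ext z
    refine ⟨fun h η hη => (h η hη).le, fun h η hη => (h η hη).lt_of_ne fun h' => ?_⟩
    have := eq_zero_of_nonneg_eigenvector hμ hw z.2.1.le hL h (fun η _ => heig z η) hη h'.symm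
      (jwSign_emptyConfig L)
    rw [h0] at this
    exact one_ne_zero this
  have hopen : IsOpen {z | ∀ η, jwSign L η = 1 → 0 < ψ z η} := by
    simp only [Set.ofPred_forall]
    exact isOpen_iInter_of_finite fun η => isOpen_iInter_of_finite fun _ =>
      isOpen_lt continuous_const (hc η)
  have hclosed : IsClosed {z | ∀ η, jwSign L η = 1 → 0 < ψ z η} := by
    rw [hS]
    simp only [Set.ofPred_forall]
    exact isClosed_iInter fun η => isClosed_iInter fun _ => isClosed_le continuous_const (hc η)
  have hne : {z | ∀ η, jwSign L η = 1 → 0 < ψ z η}.Nonempty := by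
    refine ⟨⟨1, by simp⟩, ?_⟩
    set f := ψ ⟨1, by simp⟩ with hf
    obtain ⟨η₀, h1, h2⟩ := Set.exists_min_image {η : Config L | jwSign L η = 1} f
      (Set.toFinite _) ⟨_, jwSign_emptyConfig L⟩
    -- At `z = 1` constants lie in the kernel, so `f` minus its minimum is a nonnegative null vector
    -- with a zero, hence vanishes on the even sector.
    have hconst : ∀ η, jwSign L η = 1 → f η - f η₀ = 0 := by
      intro η hη
      refine eq_zero_of_nonneg_eigenvector (c := 0) (f := fun η => f η - f η₀) hμ hw zero_le_one hL
        (fun η hη => sub_nonneg.2 (h2 η hη)) (fun η _ => ?_) h1 (sub_self _) hη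
      have := heig ⟨1, by simp⟩ η
      rw [tiltedGen_one_sub_const, zero_mul]
      exact this.trans (by simp [topEigenvalue_one hμ hw hL])
    intro η hη
    have e1 := hconst η hη
    have e2 := hconst _ (jwSign_emptyConfig L)
    have e3 : f (emptyConfig L) = 1 := h0 _
    change 0 < f η
    linarith
  have : PreconnectedSpace (Set.Ioc (0 : ℝ) 1) := Subtype.preconnectedSpace isPreconnected_Ioc
  have huniv := IsClopen.eq_univ ⟨hclosed, hopen⟩ hne
  intro z
  exact (huniv ▸ Set.mem_univ z : z ∈ {z | ∀ η, jwSign L η = 1 → 0 < ψ z η})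

theorem jwSign_eq_one_iff (hL : 0 < L) (η : Config L) :
    jwSign L η = 1 ↔ Even (particleNumber η) := by
  have : NeZero L := ⟨hL.ne'⟩
  have h : {k | η k = true} =
      (((Finset.range L).filter fun i : ℕ => η (i : ZMod L) = true).image
        (fun i : ℕ => (i : ZMod L)) : Finset (ZMod L)) := by
    ext k
    simp only [Set.mem_ofPred_eq, Finset.coe_image, Finset.coe_filter, Finset.mem_range,
      Set.mem_image]
    refine ⟨fun hk => ⟨k.val, ⟨ZMod.val_lt k, ?_⟩, ZMod.natCast_zmod_val k⟩, ?_⟩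
    · rwa [ZMod.natCast_zmod_val]
    · rintro ⟨i, ⟨-, hi⟩, rfl⟩
      exact hi
  rw [particleNumber, h, Set.ncard_coe_finset, Finset.card_image_of_injOn, jwSign,
    Finset.prod_ite, Finset.prod_const, Finset.prod_const_one, mul_one]
  · exact neg_one_pow_eq_one_iff_even (by norm_num)
  · intro i hi j hj hij
    simp only [Finset.coe_filter, Finset.mem_range, Set.mem_ofPred_eq] at hi hj
    exact (natCast_inj_of_lt hi.1 hj.1).1 hij

end Positivity

/-! ### Exponentials of bounded operators and invariant cones -/

section Semigroup

variable {E : Type*} [NormedAddCommGroup E] [NormedSpace ℝ E] [CompleteSpace E]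

theorem hasSum_exp_apply (T : E →L[ℝ] E) (f : E) :
    HasSum (fun n : ℕ => ((n.factorial : ℝ)⁻¹) • (T ^ n) f) (NormedSpace.exp T f) := by
  have h := NormedSpace.exp_series_hasSum_exp' (𝕂 := ℝ) T
  simpa using h.mapL (ContinuousLinearMap.apply ℝ E f)

theorem exp_apply_eigenvector {T : E →L[ℝ] E} {f : E} {c : ℝ} (h : T f = c • f) :
    NormedSpace.exp T f = Real.exp c • f := by
  have hn : ∀ n : ℕ, (T ^ n) f = c ^ n • f := by
    intro n
    induction n with
    | zero => simp
    | succ n ih => rw [pow_succ', mul_apply_eq_comp, ih, map_smul, h, smul_smul, pow_succ]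
  have h1 := hasSum_exp_apply T f
  have h2 : HasSum (fun n : ℕ => ((n.factorial : ℝ)⁻¹) • (T ^ n) f) (Real.exp c • f) := by
    have := (NormedSpace.exp_series_hasSum_exp' (𝕂 := ℝ) c).smul_const f
    rw [← Real.exp_eq_exp_ℝ] at this
    simpa only [hn, smul_smul, smul_eq_mul] using this
  exact h1.unique h2

/-- The exponential of an operator preserves a closed convex cone if the operator shifted by a
multiple of the identity does. -/
theorem exp_mem_of_shift_mem {T : E →L[ℝ] E} {P : Set E} (hP : IsClosed P) (h0 : (0 : E) ∈ P)
    (hadd : ∀ f ∈ P, ∀ g ∈ P, f + g ∈ P) (hsmul : ∀ a : ℝ, 0 ≤ a → ∀ f ∈ P, a • f ∈ P) (c : ℝ)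
    (hT : ∀ f ∈ P, T f + c • f ∈ P) {f : E} (hf : f ∈ P) : NormedSpace.exp T f ∈ P := by
  set S : E →L[ℝ] E := T + c • 1 with hS
  have hpow : ∀ n : ℕ, (S ^ n) f ∈ P := by
    intro n
    induction n with
    | zero => simpa using hf
    | succ n ih =>
      rw [pow_succ', mul_apply_eq_comp]
      simpa [hS] using hT _ ih
  have hexp : NormedSpace.exp S f ∈ P := by
    refine hP.mem_of_tendsto (hasSum_exp_apply S f) (Eventually.of_forall fun s => ?_)
    induction s using Finset.cons_induction with
    | empty => simpa using h0
    | cons n s hn ih =>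
      rw [Finset.sum_cons]
      exact hadd _ (hsmul _ (by positivity) _ (hpow n)) _ ih
  let _ : NormedAlgebra ℚ (E →L[ℝ] E) := NormedAlgebra.restrictScalars ℚ ℝ _
  have hcomm : Commute S ((-c) • (1 : E →L[ℝ] E)) :=
    (Commute.one_right S).smul_right (-c)
  have h1 : T = S + (-c) • 1 := by rw [hS]; simp
  have h2 : NormedSpace.exp T f = Real.exp (-c) • NormedSpace.exp S f := by
    rw [h1, NormedSpace.exp_add_of_commute hcomm, mul_apply_eq_comp,
      exp_apply_eigenvector (c := -c) (f := f) (by simp), map_smul]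
  rw [h2]
  exact hsmul _ (Real.exp_pos _).le _ hexp

end Semigroup

/-! ### The moment generating function and its growth rate -/

section MomentGen

variable {L : ℕ}

theorem jointGen_apply (w μ : ℝ) (f : BddFun L) (x : JointState L) :
    jointGen w μ L f x = jointGenFun w μ L f x := rfl

theorem continuous_bddFun_apply (x : JointState L) : Continuous fun f : BddFun L => f x :=
  (lp.evalCLM ℝ (fun _ : JointState L => ℝ) ∞ x).continuous

/-- The semigroup preserves nonnegativity on the even sector. -/
theorem semigroup_nonneg {w μ : ℝ} (hμ : 0 < μ) (hw : 0 < w) (hL : 2 ≤ L) {t : ℝ} (ht : 0 ≤ t)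
    {f : BddFun L} (hf : ∀ η a, jwSign L η = 1 → 0 ≤ f (η, a)) {η : Config L} {a : ℕ}
    (hη : jwSign L η = 1) : 0 ≤ semigroup w μ L t f (η, a) := by
  set P : Set (BddFun L) := {f | ∀ η a, jwSign L η = 1 → 0 ≤ f (η, a)} with hPdef
  suffices h : semigroup w μ L t f ∈ P from h η a hη
  have hclosed : IsClosed P := by
    simp only [hPdef, Set.ofPred_forall]
    exact isClosed_iInter fun η => isClosed_iInter fun a => isClosed_iInter fun _ =>
      isClosed_le continuous_const (continuous_bddFun_apply _)
  -- An upper bound for the total exit rate: adding it to the generator makes the diagonal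
  -- nonnegative.
  set C : ℝ := L * (μ + 2 * w) with hC
  refine exp_mem_of_shift_mem hclosed (fun η a _ => le_rfl) (fun f hf g hg η a h => ?_)
    (fun b hb f hf η a h => ?_) (t * C) (fun f hf η a h => ?_) hf
  · rw [lp.coeFn_add]
    exact add_nonneg (hf η a h) (hg η a h)
  · rw [lp.coeFn_smul]
    exact mul_nonneg hb (hf η a h)
  · have e : (t • jointGen w μ L) f + (t * C) • f = t • (jointGen w μ L f + C • f) := by
      rw [smul_apply, smul_add, smul_smul]
    rw [e, lp.coeFn_smul, lp.coeFn_add, lp.coeFn_smul]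
    refine mul_nonneg ht ?_
    simp only [Pi.add_apply, Pi.smul_apply, smul_eq_mul, jointGen_apply, jointGenFun]
    have h2 : C * f (η, a) = ∑ k ∈ Finset.range L, (μ + 2 * w) * f (η, a) := by
      rw [Finset.sum_const, Finset.card_range, nsmul_eq_mul, hC]; ring
    rw [h2, ← Finset.sum_add_distrib]
    refine Finset.sum_nonneg fun k hk => ?_
    have hk := Finset.mem_range.1 hk
    have hflip : jwSign L (flip (k : ZMod L) η) = 1 := by rw [jwSign_flip hL hk, h]
    have h3 := hf _ a hflip
    have h4 := hf _ (a + 1) hflip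
    have h5 := hf _ a h
    have o1 := occ_nonneg η (k : ZMod L)
    have o2 := occ_nonneg η ((k : ZMod L) + 1)
    have o3 := (abs_le.1 (abs_occ_le_one η (k : ZMod L))).2
    have o4 := (abs_le.1 (abs_occ_le_one η ((k : ZMod L) + 1))).2
    have h6 : rate w μ η (k : ZMod L) ≤ μ + 2 * w := by unfold rate; nlinarith
    have h7 := mul_le_mul_of_nonneg_right h6 h5
    have h8 := mul_nonneg hμ.le h3
    have h9 := mul_nonneg (mul_nonneg hw.le (add_nonneg o1 o2)) h4
    linarith

/-- The function `(η, a) ↦ exp (s a) ψ η`. -/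
def expWeight {s : ℝ} (hs : s < 0) (ψ : Config L → ℝ) [NeZero L] : BddFun L :=
  ⟨fun x => Real.exp (s * x.2) * ψ x.1, memℓp_infty ⟨∑ η, |ψ η|, by
    rintro _ ⟨x, rfl⟩
    have h1 : Real.exp (s * x.2) ≤ 1 := Real.exp_le_one_iff.2
      (mul_nonpos_of_nonpos_of_nonneg hs.le (by positivity))
    have h2 : |ψ x.1| ≤ ∑ η, |ψ η| :=
      Finset.single_le_sum (f := fun η => |ψ η|) (fun _ _ => abs_nonneg _) (Finset.mem_univ x.1)
    dsimp only
    rw [norm_mul, Real.norm_of_nonneg (Real.exp_pos _).le, Real.norm_eq_abs]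
    exact (mul_le_of_le_one_left (abs_nonneg _) h1).trans h2⟩⟩

theorem expWeight_apply {s : ℝ} (hs : s < 0) (ψ : Config L → ℝ) [NeZero L] (x : JointState L) :
    expWeight hs ψ x = Real.exp (s * x.2) * ψ x.1 := rfl

/-- Raising the activity by one multiplies the weight by `exp s`, so on such functions the joint
generator acts as the tilted one with `z = exp s`. -/
theorem jointGen_expWeight {w μ s c : ℝ} (hs : s < 0) {ψ : Config L → ℝ} [NeZero L]
    (hψ : ∀ η, tiltedGen w μ L (Real.exp s) ψ η = c * ψ η) :
    jointGen w μ L (expWeight hs ψ) = c • expWeight hs ψ := by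
  ext x
  rw [lp.coeFn_smul, Pi.smul_apply, jointGen_apply, smul_eq_mul, expWeight_apply, mul_left_comm,
    ← hψ, jointGenFun, tiltedGen, Finset.mul_sum]
  refine Finset.sum_congr rfl fun k _ => ?_
  simp only [expWeight_apply]
  rw [show s * ((x.2 + 1 : ℕ) : ℝ) = s * x.2 + s by push_cast; ring, Real.exp_add]
  ring

/-- For `s < 0` the weighted indicators form a series dominated in sup norm by a geometric one, so
the bounded semigroup may be taken through the sum. -/
theorem momentGen_eq_semigroup (w μ : ℝ) [NeZero L] {s : ℝ} (hs : s < 0) (η : Config L) (t : ℝ) :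
    momentGen w μ L η s t = semigroup w μ L t (expWeight hs fun _ => 1) (η, 0) := by
  have hnorm : ∀ a : ℕ, ‖Real.exp (s * a) • activityIndicator L a‖ ≤ Real.exp s ^ a := by
    intro a
    rw [norm_smul, Real.norm_of_nonneg (Real.exp_pos _).le, ← Real.exp_nat_mul, mul_comm s]
    refine mul_le_of_le_one_right (Real.exp_pos _).le (lp.norm_le_of_forall_le zero_le_one ?_)
    intro x
    change ‖if x.2 = a then (1 : ℝ) else 0‖ ≤ 1
    split_ifs <;> simp
  have hsum : Summable fun a : ℕ => Real.exp (s * a) • activityIndicator L a :=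
    Summable.of_norm_bounded
      (summable_geometric_of_lt_one (Real.exp_pos _).le (Real.exp_lt_one_iff.2 hs)) hnorm
  have htot : ∑' a : ℕ, Real.exp (s * a) • activityIndicator L a = expWeight hs fun _ => 1 := by
    ext x
    have h1 := hsum.hasSum.mapL (lp.evalCLM ℝ (fun _ : JointState L => ℝ) ∞ x)
    have h2 : HasSum (fun a : ℕ => if a = x.2 then Real.exp (s * x.2) else 0)
        (Real.exp (s * x.2)) := hasSum_ite_eq _ _
    rw [expWeight_apply, mul_one]
    refine h1.unique (h2.congr_fun fun a => ?_)
    rw [map_smul]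
    change Real.exp (s * a) * (if x.2 = a then (1 : ℝ) else 0) = _
    rcases eq_or_ne a x.2 with rfl | h
    · simp
    · simp [h, h.symm]
  have h := (htot ▸ hsum.hasSum).mapL ((lp.evalCLM ℝ (fun _ : JointState L => ℝ) ∞ (η, 0)).comp
    (semigroup w μ L t))
  refine (tsum_congr fun a => ?_).trans h.tsum_eq
  rw [map_smul]
  rfl

theorem tendsto_log_div_of_exp_bounds {M : ℝ → ℝ} {a b c l : ℝ} (ha : 0 < a)
    (h1 : ∀ t, 0 ≤ t → a * Real.exp (t * c) ≤ M t) (h2 : ∀ t, 0 ≤ t → M t ≤ b * Real.exp (t * c)) :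
    Tendsto (fun t => Real.log (M t) / (l * t)) atTop (𝓝 (c / l)) := by
  have hb : 0 < b := by
    have := (h1 0 le_rfl).trans (h2 0 le_rfl)
    simp at this
    linarith
  have key : Tendsto (fun t => Real.log (M t) / t) atTop (𝓝 c) := by
    have hlim : ∀ d : ℝ, Tendsto (fun t : ℝ => d / t + c) atTop (𝓝 c) := fun d => by
      simpa using (tendsto_const_nhds.div_atTop tendsto_id).add_const c
    refine tendsto_of_tendsto_of_tendsto_of_le_of_le' (hlim (Real.log a)) (hlim (Real.log b)) ?_ ?_
    · filter_upwards [eventually_gt_atTop 0] with t ht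
      have h := Real.log_le_log (by positivity) (h1 t ht.le)
      rw [Real.log_mul ha.ne' (Real.exp_pos _).ne', Real.log_exp] at h
      rw [le_div_iff₀ ht, add_mul, div_mul_cancel₀ _ ht.ne']
      linarith
    · filter_upwards [eventually_gt_atTop 0] with t ht
      have hpos : 0 < M t := lt_of_lt_of_le (by positivity) (h1 t ht.le)
      have h := Real.log_le_log hpos (h2 t ht.le)
      rw [Real.log_mul hb.ne' (Real.exp_pos _).ne', Real.log_exp] at h
      rw [div_le_iff₀ ht, add_mul, div_mul_cancel₀ _ ht.ne']
      linarith
  refine (key.div_const l).congr fun t => ?_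
  rw [div_div, mul_comm]

theorem tendsto_scaledCGF {w μ s : ℝ} (hμ : 0 < μ) (hw : 0 < w) (hL : 2 ≤ L) (hs : s < 0)
    {η : Config L} (hη : jwSign L η = 1) :
    Tendsto (fun t => scaledCGF w μ L η s t) atTop
      (𝓝 (topEigenvalue w μ L (Real.exp s) / L)) := by
  have : NeZero L := ⟨by omega⟩
  obtain ⟨ψ, hpos, hodd, heig⟩ := exists_positive_eigenvector hμ hw hL (Real.exp_pos s)
    (Real.exp_lt_one_iff.2 hs).le
  set c := topEigenvalue w μ L (Real.exp s) with hc
  have hsemi : ∀ t, semigroup w μ L t (expWeight hs ψ) = Real.exp (t * c) • expWeight hs ψ := by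
    intro t
    refine exp_apply_eigenvector ?_
    rw [smul_apply, jointGen_expWeight hs heig, smul_smul]
  have hval : ∀ t, semigroup w μ L t (expWeight hs ψ) (η, 0) = Real.exp (t * c) * ψ η := by
    intro t
    rw [hsemi, lp.coeFn_smul, Pi.smul_apply, smul_eq_mul, expWeight_apply]
    simp
  obtain ⟨η₁, he₁, hmin⟩ := Set.exists_min_image {η : Config L | jwSign L η = 1} ψ
    (Set.toFinite _) ⟨η, hη⟩
  obtain ⟨η₂, he₂, hmax⟩ := Set.exists_max_image {η : Config L | jwSign L η = 1} ψ
    (Set.toFinite _) ⟨η, hη⟩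
  have hm₁ := hpos _ he₁
  have hm₂ := hpos _ he₂
  refine tendsto_log_div_of_exp_bounds (a := ψ η / ψ η₂) (b := ψ η / ψ η₁)
    (div_pos (hpos _ hη) hm₂) (fun t ht => ?_) (fun t ht => ?_)
  -- On the even sector `ψ ≤ max ψ`; order preservation turns this into the lower bound for the
  -- moment generating function, and `min ψ ≤ ψ` gives the upper bound.
  · have h := semigroup_nonneg (a := 0) (f := ψ η₂ • expWeight hs (fun _ => 1) - expWeight hs ψ)
      hμ hw hL ht (fun η' a h' => ?_) hη
    · rw [map_sub, map_smul, lp.coeFn_sub, Pi.sub_apply, hval, lp.coeFn_smul, Pi.smul_apply,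
        smul_eq_mul, ← momentGen_eq_semigroup] at h
      rw [div_mul_eq_mul_div, div_le_iff₀ hm₂]
      linarith
    · rw [lp.coeFn_sub, Pi.sub_apply, lp.coeFn_smul, Pi.smul_apply, smul_eq_mul, expWeight_apply,
        expWeight_apply]
      have := mul_le_mul_of_nonneg_left (hmax η' h') (Real.exp_pos (s * a)).le
      dsimp only
      linarith
  · have h := semigroup_nonneg (a := 0) (f := expWeight hs ψ - ψ η₁ • expWeight hs (fun _ => 1))
      hμ hw hL ht (fun η' a h' => ?_) hη
    · rw [map_sub, map_smul, lp.coeFn_sub, Pi.sub_apply, hval, lp.coeFn_smul, Pi.smul_apply,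
        smul_eq_mul, ← momentGen_eq_semigroup] at h
      rw [div_mul_eq_mul_div, le_div_iff₀ hm₁]
      linarith
    · rw [lp.coeFn_sub, Pi.sub_apply, lp.coeFn_smul, Pi.smul_apply, smul_eq_mul, expWeight_apply,
        expWeight_apply]
      have := mul_le_mul_of_nonneg_left (hmin η' h') (Real.exp_pos (s * a)).le
      dsimp only
      linarith

theorem limitCGF_eq {w μ s : ℝ} (hμ : 0 < μ) (hw : 0 < w) (hL : 2 ≤ L) (hs : s < 0) :
    limitCGF w μ L s = topEigenvalue w μ L (Real.exp s) / L :=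
  (tendsto_scaledCGF hμ hw hL hs (jwSign_emptyConfig L)).limUnder_eq

end MomentGen

end DLPAD

end

theorem mainTheorem8 (w μ : ℝ) (hμ : 0 < μ) (hμw : μ < w) :
    -- the limit defining the generating function exists, does not depend on the initial
    -- configuration in the even sector, and is analytic at the critical point
    (∀ L : ℕ, 2 ≤ L →
      (∀ s : ℝ, s < 0 → ∀ η : DLPAD.Config L, Even (DLPAD.particleNumber η) →
        Tendsto (fun t : ℝ => DLPAD.scaledCGF w μ L η s t) atTop (𝓝 (DLPAD.limitCGF w μ L s))) ∧
      AnalyticAt ℝ (DLPAD.limitCGF w μ L) (DLPAD.criticalPoint w μ)) ∧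
    -- cumulants of orders `2k` and `2k+1` diverge, at the same order in `L`
    (∀ k : ℕ, 1 ≤ k →
      Tendsto (fun L : ℕ => |DLPAD.criticalCumulant w μ (2 * k) L|) atTop atTop ∧
      Tendsto (fun L : ℕ => |DLPAD.criticalCumulant w μ (2 * k + 1) L|) atTop atTop ∧
      (fun L : ℕ => DLPAD.criticalCumulant w μ (2 * k + 1) L) =Θ[atTop]
        (fun L : ℕ => DLPAD.criticalCumulant w μ (2 * k) L)) ∧
    -- limits of the rescaled cumulants of order `n ≥ 3`
    (∀ n : ℕ, 3 ≤ n → Odd n →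
      Tendsto (fun L : ℕ => (L : ℝ) ^ (2 - (n : ℤ)) * DLPAD.criticalCumulant w μ n L)
        atTop (𝓝 0)) ∧
    (∀ n m : ℕ, 3 ≤ n → n = 2 * m →
      Tendsto (fun L : ℕ => (L : ℝ) ^ (2 - (n : ℤ)) * DLPAD.criticalCumulant w μ n L)
        atTop (𝓝 (2 * w * DLPAD.kappaStarEven (1 - μ / w) m))) := by
  have hw := hμ.trans hμw
  have hlim : ∀ L, 2 ≤ L → ∀ s < 0,
      DLPAD.limitCGF w μ L s = DLPAD.topEigenvalue w μ L (Real.exp s) / L :=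
    fun L hL s hs => DLPAD.limitCGF_eq hμ hw hL hs
  refine ⟨fun L hL => ⟨fun s hs η hη => ?_, DLPAD.analyticAt_limitCGF hμ hμw (hlim L hL)⟩,
    DLPAD.cumulants_of_limitCGF_eq hμ hμw hlim⟩
  rw [hlim L hL s hs]
  exact DLPAD.tendsto_scaledCGF hμ hw hL hs ((DLPAD.jwSign_eq_one_iff (by omega) η).2 hη)
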